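/- Let $M$ be a connected smooth $n$-dimensional manifold with a smooth (pseudo-)Riemannian metric $g_{ij}$ of arbitrary signature, let $J\subseteq\mathbb R$ be a nonempty open interval (for example $J=\mathbb R$), and let $f(x,u)$ be a smooth function on $M\times J$. Consider the Poisson equation $$\Delta u=f(x,u),\qquad \Delta u=g^{ij}u_{ij}-\Gamma^i u_i,\quad \Gamma^i=g^{jk}\Gamma^i_{jk},$$ where $\Gamma^i_{jk}$ are the Christoffel symbols of $g$. Put $H=g^{ij}u_{ij}-\Gamma^iu_i-f(x,u)$. A smooth vector field $X=\xi^i(x,u)\partial_i+\eta(x,u)\partial_u$ on $M\times J$ is a *Lie point symmetry* of the equation if in every local chart there is a function $\lambda$ on the second order jets $(x,u,u_i,u_{ij})$ with $X^{[2]}H=\lambda H$, where $X^{[2]}=X+\eta_{[i]}\partial_{u_i}+\eta_{[ij]}\partial_{u_{ij}}$ is the second prolongation: $\eta_{[i]}=D_i\eta-u_jD_i\xi^j$, $\eta_{[ij]}=D_j\eta_{[i]}-u_{ik}D_j\xi^k$, with $D_i$ the total derivatives. A *conformal Killing vector* with conformal factor $\psi$ is a smooth vector field $\xi$ on $M$ with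 $L_\xi g_{ij}=2\psi g_{ij}$, where $\psi$ is a smooth function on $M$. **Theorem.** a) If $n>2$, then $X$ is a Lie point symmetry of $\Delta u=f(x,u)$ if and only if $$X=\xi^i(x)\,\partial_i+\Big(\tfrac{2-n}{2}\psi(x)\,u+a_0u+b(x)\Big)\partial_u,$$ where $\xi$ is a conformal Killing vector of $g$ (in particular independent of $u$) with conformal factor $\psi$, $a_0$ is a real constant, $b$ is a smooth function on $M$, and for all $x\in M$, $u\in J$, $$\tfrac{2-n}{2}\,u\,\Delta\psi+\Delta b-\xi^kf_{,k}-\Big(\tfrac{2-n}{2}\psi+a_0\Big)u f_{,u}+\Big(a_0-\tfrac{n+2}{2}\psi\Big)f-b f_{,u}=0 .$$ b) If $n=2$, then $X$ is a Lie point symmetry of $\Delta u=f(x,u)$ if and only if $$X=\xi^i(x)\,\partial_i+\big(a_0u+b(x)\big)\partial_u,$$ where $\xi$ is a conformal Killing vector of $g$ with conformal factor $\psi$, $a_0$ is a real constant, $b$ is a smooth function on $M$, and for all $x\in M$, $u\in J$, $$\Delta b-\xi^kf_{,k}-a_0uf_{,u}+(a_0-2\psi)f-bf_{,u}=0 .$$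 -/

import Mathlib

open Set
open scoped Manifold ContDiff Bundle

attribute [-instance] TopCat.of.chartedSpace

noncomputable section

namespace PoissonSymmetry

/-- The model space `ℝⁿ`. -/
abbrev E (n : ℕ) : Type := EuclideanSpace ℝ (Fin n)

/-- The `i`-th coordinate vector of `ℝⁿ`. -/
def e {n : ℕ} (i : Fin n) : E n := EuclideanSpace.single i 1

/-- The partial derivative `∂F/∂xⁱ`. -/
def pd {n : ℕ} (i : Fin n) (F : E n → ℝ) (x : E n) : ℝ := fderiv ℝ F x (e i)

/-! ### Local coordinates: Christoffel symbols, Laplacian, Lie derivative of the metric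

Below, `G : ℝⁿ → Matrix` is the matrix `(g_{ij})` of components of a metric. -/

/-- The Christoffel symbol `Γⁱ_{jk} = ½ g^{il} (∂_j g_{lk} + ∂_k g_{lj} - ∂_l g_{jk})`. -/
def christoffel {n : ℕ} (G : E n → Matrix (Fin n) (Fin n) ℝ) (i j k : Fin n) (x : E n) : ℝ :=
  (1 / 2) * ∑ l, (G x)⁻¹ i l *
    (pd j (fun y => G y l k) x + pd k (fun y => G y l j) x - pd l (fun y => G y j k) x)

/-- The contracted symbol `Γⁱ = g^{jk} Γⁱ_{jk}`. -/
def christoffelTrace {n : ℕ} (G : E n → Matrix (Fin n) (Fin n) ℝ) (i : Fin n) (x : E n) : ℝ :=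
  ∑ j, ∑ k, (G x)⁻¹ j k * christoffel G i j k x

/-- The Laplace operator as a function of the derivatives `u_i = p i`, `u_{ij} = q i j`:
`Δu = g^{ij} u_{ij} - Γⁱ u_i`. -/
def laplaceSymbol {n : ℕ} (G : E n → Matrix (Fin n) (Fin n) ℝ) (x : E n)
    (p : Fin n → ℝ) (q : Fin n → Fin n → ℝ) : ℝ :=
  ∑ i, ∑ j, (G x)⁻¹ i j * q i j - ∑ i, christoffelTrace G i x * p i

/-- The Laplacian `Δφ` of a function `φ` of the coordinates. -/
def laplacian {n : ℕ} (G : E n → Matrix (Fin n) (Fin n) ℝ) (φ : E n → ℝ) (x : E n) : ℝ :=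
  laplaceSymbol G x (fun i => pd i φ x) (fun i j => pd j (pd i φ) x)

/-- The components of the Lie derivative of the metric,
`(L_ζ g)_{ij} = ζᵏ ∂_k g_{ij} + g_{kj} ∂_i ζᵏ + g_{ik} ∂_j ζᵏ`. -/
def lieDerivMetric {n : ℕ} (G : E n → Matrix (Fin n) (Fin n) ℝ) (ζ : E n → E n) (x : E n) :
    Matrix (Fin n) (Fin n) ℝ :=
  fun i j => ∑ k, (ζ x k * pd k (fun y => G y i j) x
    + G x k j * pd i (fun y => ζ y k) x + G x i k * pd j (fun y => ζ y k) x)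

/-! ### Jets, prolongations and Lie point symmetries in local coordinates -/

/-- First order jets `(x, u, u_i)`. -/
abbrev Jet1 (n : ℕ) : Type := E n × ℝ × (Fin n → ℝ)

/-- Second order jets `(x, u, u_i, u_{ij})`. The symmetry `u_{ij} = u_{ji}` is imposed where jets
are quantified over. -/
abbrev Jet2 (n : ℕ) : Type := E n × ℝ × (Fin n → ℝ) × (Fin n → Fin n → ℝ)

/-- The first order jet underlying a second order jet. -/
def Jet2.toJet1 {n : ℕ} (z : Jet2 n) : Jet1 n := (z.1, z.2.1, z.2.2.1)

/-- The total derivative `D_i F = ∂_i F + u_i ∂_u F` of a function of `(x, u)`. -/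
def totalDeriv1 {n : ℕ} (i : Fin n) (F : E n × ℝ → ℝ) (z : Jet1 n) : ℝ :=
  fderiv ℝ F (z.1, z.2.1) (e i, z.2.2 i)

/-- The total derivative `D_i F = ∂_i F + u_i ∂_u F + u_{ij} ∂_{u_j} F` of a function of
`(x, u, u_j)`. -/
def totalDeriv2 {n : ℕ} (i : Fin n) (F : Jet1 n → ℝ) (z : Jet2 n) : ℝ :=
  fderiv ℝ F z.toJet1 (e i, z.2.2.1 i, z.2.2.2 i)

/-- `η_[i] = D_i η - u_j D_i ξʲ`. -/
def prolong1 {n : ℕ} (ξ : E n × ℝ → E n) (η : E n × ℝ → ℝ) (i : Fin n) (z : Jet1 n) : ℝ :=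
  totalDeriv1 i η z - ∑ j, z.2.2 j * totalDeriv1 i (fun p => ξ p j) z

/-- `η_[ij] = D_j η_[i] - u_{ik} D_j ξᵏ`. -/
def prolong2 {n : ℕ} (ξ : E n × ℝ → E n) (η : E n × ℝ → ℝ) (i j : Fin n) (z : Jet2 n) : ℝ :=
  totalDeriv2 j (prolong1 ξ η i) z
    - ∑ k, z.2.2.2 i k * totalDeriv1 j (fun p => ξ p k) z.toJet1

/-- The second prolongation
`X^[2] = ξⁱ ∂_i + η ∂_u + η_[i] ∂_{u_i} + η_[ij] ∂_{u_{ij}}`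
of `X = ξⁱ(x,u) ∂_i + η(x,u) ∂_u`, as a vector field on the space of second order jets. -/
def prolongation {n : ℕ} (ξ : E n × ℝ → E n) (η : E n × ℝ → ℝ) (z : Jet2 n) : Jet2 n :=
  (ξ (z.1, z.2.1), η (z.1, z.2.1), fun i => prolong1 ξ η i z.toJet1,
    fun i j => prolong2 ξ η i j z)

/-- `X = ξⁱ(x,u) ∂_i + η(x,u) ∂_u` is a Lie point symmetry of the second order equation
`H(x, u, u_i, u_{ij}) = 0` for `x ∈ U` and `u ∈ J`: there is a function `lam` of the second order
jet such that `X^[2] H = lam H`. (Equivalently, `X^[2] H` vanishes wherever `H` does.) -/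
def IsLocalLieSymmetry {n : ℕ} (U : Set (E n)) (J : Set ℝ) (H : Jet2 n → ℝ)
    (ξ : E n × ℝ → E n) (η : E n × ℝ → ℝ) : Prop :=
  ∃ lam : Jet2 n → ℝ, ∀ x ∈ U, ∀ u ∈ J, ∀ (p : Fin n → ℝ) (q : Fin n → Fin n → ℝ),
    (∀ i j, q i j = q j i) →
      fderiv ℝ H (x, u, p, q) (prolongation ξ η (x, u, p, q)) = lam (x, u, p, q) * H (x, u, p, q)

/-- The function `H = g^{ij} u_{ij} - Γⁱ u_i - F(x,u)` whose zero set is the Poisson equation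
`Δu = F(x,u)`. -/
def poissonFunction {n : ℕ} (G : E n → Matrix (Fin n) (Fin n) ℝ) (F : E n × ℝ → ℝ)
    (z : Jet2 n) : ℝ :=
  laplaceSymbol G z.1 z.2.2.1 z.2.2.2 - F (z.1, z.2.1)

/-! ### Manifolds -/

/-- A smooth (pseudo-)Riemannian metric, of arbitrary signature, on an `n`-dimensional smooth
manifold. -/
structure Metric (n : ℕ) (M : Type*) [TopologicalSpace M] [ChartedSpace (E n) M]
    [IsManifold (𝓡 n) ∞ M] where
  /-- The scalar product on each tangent space. -/
  inner (x : M) : TangentSpace (𝓡 n) x →L[ℝ] TangentSpace (𝓡 n) x →L[ℝ] ℝ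
  symm (x : M) (v w : TangentSpace (𝓡 n) x) : inner x v w = inner x w v
  nondegenerate (x : M) (v : TangentSpace (𝓡 n) x) : (∀ w, inner x v w = 0) → v = 0
  contMDiff : ContMDiff (𝓡 n) ((𝓡 n).prod 𝓘(ℝ, E n →L[ℝ] E n →L[ℝ] ℝ)) ∞
    (fun x => Bundle.TotalSpace.mk' (E n →L[ℝ] E n →L[ℝ] ℝ)
      (E := fun x : M => TangentSpace (𝓡 n) x →L[ℝ] TangentSpace (𝓡 n) x →L[ℝ] ℝ) x (inner x))

section

variable {n : ℕ} {M : Type*} [TopologicalSpace M] [ChartedSpace (E n) M]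

/-- The smooth charts of `M`. -/
def IsChart (φ : OpenPartialHomeomorph M (E n)) : Prop :=
  φ ∈ IsManifold.maximalAtlas (𝓡 n) ∞ M

/-- The components `g_{ij} = g(∂_i, ∂_j)` of a metric in a chart. -/
def Metric.coord [IsManifold (𝓡 n) ∞ M] (g : Metric n M) (φ : OpenPartialHomeomorph M (E n))
    (y : E n) : Matrix (Fin n) (Fin n) ℝ :=
  fun i j => g.inner (φ.symm y)
    (mfderiv (𝓡 n) (𝓡 n) φ.symm y (e i)) (mfderiv (𝓡 n) (𝓡 n) φ.symm y (e j))

/-- The components `ζⁱ` of a vector field on `M` in a chart. -/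
def coordField (φ : OpenPartialHomeomorph M (E n)) (ζ : (x : M) → TangentSpace (𝓡 n) x)
    (y : E n) : E n :=
  mfderiv (𝓡 n) (𝓡 n) φ (φ.symm y) (ζ (φ.symm y))

/-- The expression in a chart of a function of `(x, u)`. -/
def coordFun (φ : OpenPartialHomeomorph M (E n)) (f : M → ℝ → ℝ) (p : E n × ℝ) : ℝ :=
  f (φ.symm p.1) p.2

/-- `ζ` is a smooth vector field on `M`. -/
def IsSmoothField [IsManifold (𝓡 n) ∞ M] (ζ : (x : M) → TangentSpace (𝓡 n) x) : Prop :=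
  ContMDiff (𝓡 n) (𝓡 n).tangent ∞ (fun x => (⟨x, ζ x⟩ : TangentBundle (𝓡 n) M))

/-- `ξ` is a smooth vector field tangent to `M` depending on `x ∈ M` and `u ∈ J`. -/
def IsSmoothFieldOn [IsManifold (𝓡 n) ∞ M] (J : Set ℝ)
    (ξ : (x : M) → ℝ → TangentSpace (𝓡 n) x) : Prop :=
  ContMDiffOn ((𝓡 n).prod 𝓘(ℝ, ℝ)) (𝓡 n).tangent ∞
    (fun p : M × ℝ => (⟨p.1, ξ p.1 p.2⟩ : TangentBundle (𝓡 n) M)) (univ ×ˢ J)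

/-- `f` is a smooth function of `x ∈ M` and `u ∈ J`. -/
def IsSmoothFunOn (J : Set ℝ) (f : M → ℝ → ℝ) : Prop :=
  ContMDiffOn ((𝓡 n).prod 𝓘(ℝ, ℝ)) 𝓘(ℝ, ℝ) ∞ (fun p : M × ℝ => f p.1 p.2) (univ ×ˢ J)

/-- `ζ` is a conformal Killing vector of `g` with conformal factor `ψ`: it is smooth, `ψ` is
smooth, and `L_ζ g = 2 ψ g`. -/
structure IsConformalKilling [IsManifold (𝓡 n) ∞ M] (g : Metric n M)
    (ζ : (x : M) → TangentSpace (𝓡 n) x) (ψ : M → ℝ) : Prop where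
  smooth_field : IsSmoothField ζ
  smooth_factor : ContMDiff (𝓡 n) 𝓘(ℝ, ℝ) ∞ ψ
  lieDeriv_eq : ∀ φ : OpenPartialHomeomorph M (E n), IsChart φ → ∀ y ∈ φ.target,
    lieDerivMetric (g.coord φ) (coordField φ ζ) y = (2 * ψ (φ.symm y)) • g.coord φ y

/-- The vector field `X = ξ(x,u) + η(x,u) ∂_u` on `M × J` generates a Lie point symmetry of the
Poisson equation `Δu = f(x,u)`: it does so in every chart of `M`. -/
def IsPoissonSymmetry [IsManifold (𝓡 n) ∞ M] (g : Metric n M) (J : Set ℝ) (f : M → ℝ → ℝ)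
    (ξ : (x : M) → ℝ → TangentSpace (𝓡 n) x) (η : M → ℝ → ℝ) : Prop :=
  ∀ φ : OpenPartialHomeomorph M (E n), IsChart φ →
    IsLocalLieSymmetry φ.target J (poissonFunction (g.coord φ) (coordFun φ f))
      (fun p => coordField φ (fun x => ξ x p.2) p.1) (coordFun φ η)

end

end PoissonSymmetry

end

open PoissonSymmetry

namespace PoissonSymmetry

/-! ### Directional derivatives -/

section Calculus

variable {V : Type*} [NormedAddCommGroup V] [NormedSpace ℝ V] {f g : V → ℝ} {s : Set V} {x v w : V}

/-! The defining condition is split by powers of the jet variables. `X^[2] H` is affine in `u_{ij}`,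
and for fixed `(x, u, u_i)` the set `H = 0` is an affine hyperplane of symmetric matrices `u_{ij}`
with normal `g^{ij}`. An affine function vanishing on a hyperplane is a multiple of its equation
(`symm_eq_of_hyperplane`). So the condition says that the symmetrised coefficient of `u_{ij}` is `μ
g^{ij}` and that the remaining part is `-μ (Γⁱ u_i + f)`, with `μ` depending only on `(x, u, u_i)`
(`isLocalLieSymmetry_iff`).

The `u_i`-dependence of the first equation forces `w ⊗ w` to be proportional to `g⁻¹`, where `w =
∂ξ/∂u`. A matrix of rank at most one is not a nonzero multiple of an invertible one when `n ≥ 2`, so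
`w = 0` (`du_field_eq_zero`). With `ξ = ζ(x)`, the first equation becomes `L_ζ g = (η_u - μ) g`;
thus `ζ` is conformal Killing with `2ψ = η_u - μ`. The second equation is a quadratic polynomial in
`u_i`: its leading coefficient gives `η_uu = 0`, its constant term gives the equation relating `f`,
`ψ` and `b`, and its linear term involves the Lie derivative of the contracted Christoffel symbols.

The geometric input is that this Lie derivative equals `(2 - n) g^{ij} ∂_j ψ` for a conformal field
(`IsLocalConformal.lieDeriv_christoffelTrace`). The linear term then reads `2 ∂_j η_u = (2 - n) ∂_j
ψ`. Hence `η_u - (2 - n)/2 ψ` is constant on the connected manifold `M`; the constant is `a₀`, and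
`b` is what remains of `η`, which is affine in `u`. Each step is an equivalence once the shape of
`X` is known, which gives the converse (`isLocalLieSymmetry_affine_iff`).

To globalise, `ψ` is defined as a trace of `g⁻¹ L_ζ g` in a chart. Naturality of the Lie derivative
(`lieDerivMetric_naturality`) shows that it is independent of the chart. -/

theorem _root_.ContDiffOn.differentiableAt_of_isOpen (hf : ContDiffOn ℝ ∞ f s) (hs : IsOpen s)
    (hx : x ∈ s) : DifferentiableAt ℝ f x :=
  (hf.contDiffAt (hs.mem_nhds hx)).differentiableAt (by simp)

theorem _root_.ContDiffOn.fderiv_apply_of_isOpen (hf : ContDiffOn ℝ ∞ f s) (hs : IsOpen s) (v : V) :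
    ContDiffOn ℝ ∞ (fun y => fderiv ℝ f y v) s :=
  (hf.fderiv_of_isOpen hs (by simp)).clm_apply contDiffOn_const

theorem fderiv_congr_of_isOpen (hs : IsOpen s) (h : EqOn f g s) (hx : x ∈ s) :
    fderiv ℝ f x = fderiv ℝ g x :=
  (h.eventuallyEq_of_mem (hs.mem_nhds hx)).fderiv_eq

theorem fderiv_mul_apply (hf : DifferentiableAt ℝ f x) (hg : DifferentiableAt ℝ g x) (v : V) :
    fderiv ℝ (fun y => f y * g y) x v = fderiv ℝ f x v * g x + f x * fderiv ℝ g x v := by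
  rw [fderiv_fun_mul hf hg]
  simp; ring

theorem fderiv_add_apply (hf : DifferentiableAt ℝ f x) (hg : DifferentiableAt ℝ g x) (v : V) :
    fderiv ℝ (fun y => f y + g y) x v = fderiv ℝ f x v + fderiv ℝ g x v := by
  rw [fderiv_fun_add hf hg]; simp

theorem fderiv_sub_apply (hf : DifferentiableAt ℝ f x) (hg : DifferentiableAt ℝ g x) (v : V) :
    fderiv ℝ (fun y => f y - g y) x v = fderiv ℝ f x v - fderiv ℝ g x v := by
  rw [fderiv_fun_sub hf hg]; simp

theorem fderiv_neg_apply (v : V) :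
    fderiv ℝ (fun y => - f y) x v = - fderiv ℝ f x v := by
  rw [fderiv_fun_neg]; simp

theorem fderiv_const_mul_apply (hf : DifferentiableAt ℝ f x) (c : ℝ) (v : V) :
    fderiv ℝ (fun y => c * f y) x v = c * fderiv ℝ f x v := by
  rw [fderiv_const_mul hf]; simp

theorem fderiv_sum_apply {ι : Type*} [Fintype ι] {h : ι → V → ℝ}
    (hh : ∀ i, DifferentiableAt ℝ (h i) x) (v : V) :
    fderiv ℝ (fun y => ∑ i, h i y) x v = ∑ i, fderiv ℝ (h i) x v := by
  rw [fderiv_fun_sum fun i _ => hh i]; simp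

theorem fderiv_fderiv_comm (hf : ContDiffOn ℝ ∞ f s) (hs : IsOpen s) (hx : x ∈ s) (v w : V) :
    fderiv ℝ (fun y => fderiv ℝ f y v) x w = fderiv ℝ (fun y => fderiv ℝ f y w) x v := by
  have hd : DifferentiableAt ℝ (fderiv ℝ f) x :=
    ((hf.fderiv_of_isOpen hs (m := ∞) (by simp)).contDiffAt (hs.mem_nhds hx)).differentiableAt
      (by simp)
  have hsymm := (hf.contDiffAt (hs.mem_nhds hx)).isSymmSndFDerivAt
    (by simpa using (WithTop.coe_le_coe.2 le_top : (2 : WithTop ℕ∞) ≤ ∞))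
  rw [fderiv_clm_apply hd (differentiableAt_const v), fderiv_clm_apply hd (differentiableAt_const w)]
  simpa using hsymm w v

end Calculus

section Coordinates

variable {n : ℕ} {f : E n → ℝ} {U : Set (E n)} {x : E n}

theorem sum_smul_e (v : E n) : ∑ i, v i • (e i : E n) = v := by
  ext j
  simp [e, Finset.sum_apply, Pi.single_apply]

theorem fderiv_apply_eq_sum_pd (v : E n) : fderiv ℝ f x v = ∑ k, v k * pd k f x := by
  conv_lhs => rw [← sum_smul_e v]
  simp [pd]

theorem pd_congr {g : E n → ℝ} (hU : IsOpen U) (h : EqOn f g U) (hx : x ∈ U) (i : Fin n) :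
    pd i f x = pd i g x := by
  rw [pd, fderiv_congr_of_isOpen hU h hx, pd]

theorem _root_.ContDiffOn.pd (hf : ContDiffOn ℝ ∞ f U) (hU : IsOpen U) (i : Fin n) :
    ContDiffOn ℝ ∞ (PoissonSymmetry.pd i f) U :=
  hf.fderiv_apply_of_isOpen hU (e i)

theorem pd_comm (hf : ContDiffOn ℝ ∞ f U) (hU : IsOpen U) (hx : x ∈ U) (i j : Fin n) :
    pd i (pd j f) x = pd j (pd i f) x :=
  fderiv_fderiv_comm hf hU hx (e j) (e i)

end Coordinates

/-! ### Local geometry -/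

section LocalMetric

variable {n : ℕ}

/-- `G` is the matrix of components of a smooth metric on the open set `U`. -/
structure IsLocalMetric (G : E n → Matrix (Fin n) (Fin n) ℝ) (U : Set (E n)) : Prop where
  isOpen : IsOpen U
  smooth (i j : Fin n) : ContDiffOn ℝ ∞ (fun y => G y i j) U
  symm {y : E n} (hy : y ∈ U) (i j : Fin n) : G y i j = G y j i
  isUnit_det {y : E n} (hy : y ∈ U) : IsUnit (G y).det

/-- The entrywise derivative of a matrix valued function in the direction `v`. -/
noncomputable def dmat (A : E n → Matrix (Fin n) (Fin n) ℝ) (x v : E n) : Matrix (Fin n) (Fin n) ℝ :=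
  Matrix.of fun i j => fderiv ℝ (fun y => A y i j) x v

theorem contDiffOn_det {A : E n → Matrix (Fin n) (Fin n) ℝ} {U : Set (E n)}
    (hA : ∀ i j, ContDiffOn ℝ ∞ (fun y => A y i j) U) : ContDiffOn ℝ ∞ (fun y => (A y).det) U := by
  simp only [Matrix.det_apply]
  refine ContDiffOn.sum fun σ _ => ContDiffOn.const_smul _ ?_
  exact contDiffOn_prod fun i _ => hA _ _

variable {G : E n → Matrix (Fin n) (Fin n) ℝ} {U : Set (E n)} {x : E n}

namespace IsLocalMetric

/-- Cramer's rule: entries of the adjugate are determinants of matrices with smooth entries, and the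
determinant does not vanish on `U`. -/
theorem smooth_inv (hG : IsLocalMetric G U) (i j : Fin n) :
    ContDiffOn ℝ ∞ (fun y => (G y)⁻¹ i j) U := by
  have h1 : ContDiffOn ℝ ∞ (fun y => ((G y).det)⁻¹ * (G y).adjugate i j) U := by
    refine ((contDiffOn_det hG.smooth).inv fun y hy => (hG.isUnit_det hy).ne_zero).mul ?_
    simp only [Matrix.adjugate_apply]
    refine contDiffOn_det fun a b => ?_
    by_cases h : a = j
    · subst h
      simp only [Matrix.updateRow_self]
      exact contDiffOn_const
    · simp only [Matrix.updateRow_ne h]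
      exact hG.smooth a b
  refine h1.congr fun y _ => ?_
  rw [Matrix.inv_def, Matrix.smul_apply, smul_eq_mul, Ring.inverse_eq_inv']

theorem inv_symm (hG : IsLocalMetric G U) (hx : x ∈ U) (i j : Fin n) :
    (G x)⁻¹ i j = (G x)⁻¹ j i := by
  have h : (G x).IsSymm := Matrix.IsSymm.ext fun a b => hG.symm hx b a
  have h2 : ((G x)⁻¹).transpose = (G x)⁻¹ := by rw [Matrix.transpose_nonsing_inv, h.eq]
  conv_lhs => rw [← h2]
  rfl

/-- Obtained by differentiating `g⁻¹ g = 1` and multiplying by `g⁻¹` on the right. -/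
theorem dmat_inv (hG : IsLocalMetric G U) (hx : x ∈ U) (v : E n) :
    dmat (fun y => (G y)⁻¹) x v = -((G x)⁻¹ * dmat G x v * (G x)⁻¹) := by
  have key : dmat (fun y => (G y)⁻¹) x v * G x + (G x)⁻¹ * dmat G x v = 0 := by
    ext i j
    have h1 : EqOn (fun y => ∑ k, (G y)⁻¹ i k * G y k j) (fun _ => (1 : Matrix _ _ ℝ) i j) U :=
      fun y hy => by
        simp only [← Matrix.mul_apply]
        rw [Matrix.nonsing_inv_mul _ (hG.isUnit_det hy)]
    have h2 := DFunLike.congr_fun (fderiv_congr_of_isOpen hG.isOpen h1 hx) v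
    have hd1 := fun i j => (hG.smooth i j).differentiableAt_of_isOpen hG.isOpen hx
    have hd2 := fun i j => (hG.smooth_inv i j).differentiableAt_of_isOpen hG.isOpen hx
    rw [fderiv_sum_apply fun k => (hd2 i k).fun_mul (hd1 k j)] at h2
    simp only [fderiv_mul_apply (hd2 i _) (hd1 _ j)] at h2
    simpa [Matrix.mul_apply, dmat, Finset.sum_add_distrib] using h2
  have h3 := congrArg (· * (G x)⁻¹) key
  simp only [add_mul, zero_mul, Matrix.mul_assoc,
    Matrix.mul_nonsing_inv _ (hG.isUnit_det hx), Matrix.mul_one] at h3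
  rw [Matrix.mul_assoc]
  exact eq_neg_of_add_eq_zero_left h3

theorem fderiv_inv_apply (hG : IsLocalMetric G U) (hx : x ∈ U) (v : E n) (i j : Fin n) :
    fderiv ℝ (fun y => (G y)⁻¹ i j) x v =
      -∑ a, ∑ b, (G x)⁻¹ i a * fderiv ℝ (fun y => G y a b) x v * (G x)⁻¹ b j := by
  have h := congrFun (congrFun (hG.dmat_inv hx v) i) j
  rw [Matrix.neg_apply, Matrix.mul_apply] at h
  simp only [Matrix.mul_apply, Finset.sum_mul, dmat, Matrix.of_apply] at h
  rw [h, Finset.sum_comm]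

end IsLocalMetric

/-- `½ g^{jk} ∂_l g_{jk}`, the logarithmic derivative of the volume density. -/
noncomputable def logDensityDeriv (G : E n → Matrix (Fin n) (Fin n) ℝ) (l : Fin n) (x : E n) : ℝ :=
  (1 / 2) * ∑ j, ∑ k, (G x)⁻¹ j k * pd l (fun y => G y j k) x

namespace IsLocalMetric

/-- The divergence form of the contracted symbol, `Γⁱ = -∂_j g^{ij} - g^{ij} σ_j` with `σ` the
logarithmic derivative of the density. It contains only quantities whose behaviour under a conformal
field is immediate: `g^{ij}` and `σ_j`. -/
theorem christoffelTrace_eq (hG : IsLocalMetric G U) (hx : x ∈ U) (i : Fin n) :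
    christoffelTrace G i x = -∑ j, pd j (fun y => (G y)⁻¹ i j) x
      - ∑ j, (G x)⁻¹ i j * logDensityDeriv G j x := by
  set P := (G x)⁻¹ with hP
  have hs : ∀ i j, P i j = P j i := hG.inv_symm hx
  have h1 : ∀ j, pd j (fun y => (G y)⁻¹ i j) x =
      -∑ a, ∑ b, P i a * pd j (fun y => G y a b) x * P b j :=
    fun j => hG.fderiv_inv_apply hx (e j) i j
  have h2 : ∑ j, ∑ k, ∑ l, P j k * (P i l * pd j (fun y => G y l k) x) =
      ∑ j, ∑ a, ∑ b, P i a * pd j (fun y => G y a b) x * P b j := by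
    refine Finset.sum_congr rfl fun j _ => ?_
    rw [Finset.sum_comm]
    refine Finset.sum_congr rfl fun a _ => Finset.sum_congr rfl fun b _ => ?_
    rw [hs j b]; ring
  have h3 : ∑ j, ∑ k, ∑ l, P j k * (P i l * pd k (fun y => G y l j) x) =
      ∑ j, ∑ a, ∑ b, P i a * pd j (fun y => G y a b) x * P b j := by
    rw [← h2, Finset.sum_comm]
    refine Finset.sum_congr rfl fun j _ => Finset.sum_congr rfl fun k _ => ?_
    rw [hs k j]
  have h4 : ∑ j, ∑ k, ∑ l, P j k * (P i l * pd l (fun y => G y j k) x) =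
      2 * ∑ j, P i j * logDensityDeriv G j x := by
    simp only [logDensityDeriv, Finset.mul_sum, ← hP]
    rw [Finset.sum_congr rfl fun j _ => Finset.sum_comm, Finset.sum_comm]
    refine Finset.sum_congr rfl fun l _ => Finset.sum_congr rfl fun j _ =>
      Finset.sum_congr rfl fun k _ => ?_
    ring
  have h5 : christoffelTrace G i x = (1 / 2) *
      (∑ j, ∑ k, ∑ l, P j k * (P i l * pd j (fun y => G y l k) x)
        + ∑ j, ∑ k, ∑ l, P j k * (P i l * pd k (fun y => G y l j) x)
        - ∑ j, ∑ k, ∑ l, P j k * (P i l * pd l (fun y => G y j k) x)) := by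
    simp only [christoffelTrace, christoffel, ← hP, ← Finset.sum_add_distrib,
      ← Finset.sum_sub_distrib, Finset.mul_sum]
    refine Finset.sum_congr rfl fun l _ => Finset.sum_congr rfl fun j _ =>
      Finset.sum_congr rfl fun k _ => ?_
    ring
  rw [h5, h2, h3, h4]
  simp only [h1, Finset.sum_neg_distrib]
  ring

theorem smooth_logDensityDeriv (hG : IsLocalMetric G U) (l : Fin n) :
    ContDiffOn ℝ ∞ (logDensityDeriv G l) U := by
  unfold logDensityDeriv
  exact contDiffOn_const.mul (ContDiffOn.sum fun j _ => ContDiffOn.sum fun k _ =>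
    (hG.smooth_inv j k).mul ((hG.smooth j k).pd hG.isOpen l))

theorem smooth_christoffelTrace (hG : IsLocalMetric G U) (i : Fin n) :
    ContDiffOn ℝ ∞ (christoffelTrace G i) U := by
  refine ContDiffOn.congr ?_ fun y hy => hG.christoffelTrace_eq hy i
  exact (ContDiffOn.sum fun j _ => (hG.smooth_inv i j).pd hG.isOpen j).neg.sub
    (ContDiffOn.sum fun j _ => (hG.smooth_inv i j).mul (hG.smooth_logDensityDeriv j))

/-- Closedness of the one-form `σ`, without introducing the density: `∂_k g^{ab} ∂_l g_{ab} =
-tr(g⁻¹ ∂_k g g⁻¹ ∂_l g)` is symmetric in `k, l` by cyclicity of the trace, and the other term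
contains the symmetric `∂_k ∂_l g_{ab}`. -/
theorem pd_logDensityDeriv_comm (hG : IsLocalMetric G U) (hx : x ∈ U) (i j : Fin n) :
    pd i (logDensityDeriv G j) x = pd j (logDensityDeriv G i) x := by
  have hP := fun a b => (hG.smooth_inv a b).differentiableAt_of_isOpen hG.isOpen hx
  have hd := fun l a b => ((hG.smooth a b).pd hG.isOpen l).differentiableAt_of_isOpen hG.isOpen hx
  have expand : ∀ k l, pd k (logDensityDeriv G l) x = (1 / 2) * ∑ a, ∑ b,
      (pd k (fun y => (G y)⁻¹ a b) x * pd l (fun y => G y a b) x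
        + (G x)⁻¹ a b * pd k (pd l (fun y => G y a b)) x) := by
    intro k l
    unfold logDensityDeriv
    rw [pd, fderiv_const_mul_apply (.fun_sum fun a _ => .fun_sum fun b _ => (hP a b).fun_mul (hd l a b)),
      fderiv_sum_apply (fun a => .fun_sum fun b _ => (hP a b).fun_mul (hd l a b))]
    congr 1
    refine Finset.sum_congr rfl fun a _ => ?_
    rw [fderiv_sum_apply (fun b => (hP a b).fun_mul (hd l a b))]
    refine Finset.sum_congr rfl fun b _ => ?_
    rw [fderiv_mul_apply (hP a b) (hd l a b)]
    rfl
  have hsym : ∀ k l, ∑ a, ∑ b, pd k (fun y => (G y)⁻¹ a b) x * pd l (fun y => G y a b) x =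
      -(((G x)⁻¹ * dmat G x (e k) * (G x)⁻¹) * dmat G x (e l)).trace := by
    intro k l
    rw [← Matrix.trace_neg, ← Matrix.neg_mul, ← hG.dmat_inv hx]
    simp only [Matrix.trace, Matrix.diag, Matrix.mul_apply]
    refine Finset.sum_congr rfl fun a _ => Finset.sum_congr rfl fun b _ => ?_
    simp only [dmat, Matrix.of_apply, pd]
    congr 2
    exact fderiv_congr_of_isOpen hG.isOpen (fun y hy => hG.symm hy a b) hx
  rw [expand, expand]
  simp only [Finset.sum_add_distrib, hsym]
  congr 2
  · rw [Matrix.trace_mul_comm, ← Matrix.mul_assoc, Matrix.trace_mul_comm, ← Matrix.mul_assoc,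
      ← Matrix.mul_assoc]
  · refine Finset.sum_congr rfl fun a _ => Finset.sum_congr rfl fun b _ => ?_
    rw [pd_comm (hG.smooth a b) hG.isOpen hx]

end IsLocalMetric

end LocalMetric

/-! ### Conformal Killing fields in coordinates -/

section LocalConformal

variable {n : ℕ} {G : E n → Matrix (Fin n) (Fin n) ℝ} {U : Set (E n)} {ζ : E n → E n}
  {ψ : E n → ℝ} {x : E n}

/-- The Jacobian matrix `∂_i ζᵏ`. -/
noncomputable def jac (ζ : E n → E n) (x : E n) : Matrix (Fin n) (Fin n) ℝ :=
  Matrix.of fun k i => pd i (fun y => ζ y k) x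

theorem lieDerivMetric_eq (G : E n → Matrix (Fin n) (Fin n) ℝ) (ζ : E n → E n)
    (x : E n) : lieDerivMetric G ζ x =
      dmat G x (ζ x) + (jac ζ x).transpose * G x + G x * jac ζ x := by
  ext i j
  simp only [lieDerivMetric, Matrix.add_apply, Matrix.mul_apply, dmat, jac, Matrix.of_apply,
    Matrix.transpose_apply, fderiv_apply_eq_sum_pd, Finset.sum_add_distrib]
  congr 2
  exact Finset.sum_congr rfl fun k _ => mul_comm _ _

/-- Multiplying by `g⁻¹` on both sides passes to the contravariant form. It is the inverse metric
that enters `H`, so this is the form in which the conformal equation appears in the determining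
equations. -/
theorem IsLocalMetric.lieDerivMetric_eq_smul_iff (hG : IsLocalMetric G U) (hx : x ∈ U) (c : ℝ) :
    lieDerivMetric G ζ x = c • G x ↔ dmat (fun y => (G y)⁻¹) x (ζ x) =
      (G x)⁻¹ * (jac ζ x).transpose + jac ζ x * (G x)⁻¹ - c • (G x)⁻¹ := by
  have hu := hG.isUnit_det hx
  rw [lieDerivMetric_eq, hG.dmat_inv hx]
  generalize dmat G x (ζ x) = A
  generalize jac ζ x = D
  generalize G x = g at *
  have h1 : g⁻¹ * g = 1 := Matrix.nonsing_inv_mul _ hu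
  have h2 : g * g⁻¹ = 1 := Matrix.mul_nonsing_inv _ hu
  constructor
  · intro h
    have hA : A = c • g - D.transpose * g - g * D := by rw [← h]; abel
    rw [hA]
    simp only [mul_sub, sub_mul, Matrix.mul_smul, Matrix.smul_mul, h1, Matrix.one_mul]
    rw [Matrix.mul_assoc g⁻¹ (_ * g), Matrix.mul_assoc _ g, h2, ← Matrix.mul_assoc g⁻¹ g, h1]
    simp only [Matrix.mul_one, Matrix.one_mul]
    abel
  · intro h
    have hA : A = g * (g⁻¹ * A * g⁻¹) * g := by
      rw [Matrix.mul_assoc g⁻¹, ← Matrix.mul_assoc g, h2, Matrix.one_mul, Matrix.mul_assoc, h1,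
        Matrix.mul_one]
    have h3 : g⁻¹ * A * g⁻¹ = c • g⁻¹ - g⁻¹ * D.transpose - D * g⁻¹ := by
      rw [← neg_neg (g⁻¹ * A * g⁻¹), h]; abel
    rw [h3] at hA
    rw [hA]
    simp only [mul_sub, sub_mul, Matrix.mul_smul, Matrix.smul_mul, h2, Matrix.one_mul,
      ← Matrix.mul_assoc]
    rw [Matrix.mul_assoc (g * D), h1, Matrix.mul_one]
    abel

/-- Taking the trace of `L_ζ g = c g`. -/
theorem IsLocalMetric.divergence_eq (hG : IsLocalMetric G U) (hx : x ∈ U) {c : ℝ}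
    (h : lieDerivMetric G ζ x = c • G x) :
    2 * ∑ k, ζ x k * logDensityDeriv G k x + 2 * ∑ k, pd k (fun y => ζ y k) x = n * c := by
  have hu := hG.isUnit_det hx
  have h1 : (G x)⁻¹ * G x = 1 := Matrix.nonsing_inv_mul _ hu
  have h2 : G x * (G x)⁻¹ = 1 := Matrix.mul_nonsing_inv _ hu
  have h3 := congrArg (fun A => ((G x)⁻¹ * A).trace) h
  simp only [lieDerivMetric_eq, Matrix.mul_add, Matrix.trace_add, Matrix.mul_smul, h1,
    Matrix.trace_smul, Matrix.trace_one, Fintype.card_fin, ← Matrix.mul_assoc, Matrix.one_mul] at h3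
  rw [Matrix.trace_mul_comm ((G x)⁻¹ * _), ← Matrix.mul_assoc, h2, Matrix.one_mul,
    Matrix.trace_transpose] at h3
  have h4 : (jac ζ x).trace = ∑ k, pd k (fun y => ζ y k) x := rfl
  have h5 : ((G x)⁻¹ * dmat G x (ζ x)).trace = 2 * ∑ k, ζ x k * logDensityDeriv G k x := by
    simp only [Matrix.trace, Matrix.diag, Matrix.mul_apply, dmat, Matrix.of_apply,
      fderiv_apply_eq_sum_pd, logDensityDeriv, Finset.mul_sum]
    rw [Finset.sum_congr rfl fun j _ => Finset.sum_comm, Finset.sum_comm]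
    refine Finset.sum_congr rfl fun l _ => Finset.sum_congr rfl fun j _ =>
      Finset.sum_congr rfl fun k _ => ?_
    have : pd l (fun y => G y k j) x = pd l (fun y => G y j k) x :=
      pd_congr hG.isOpen (fun y hy => hG.symm hy k j) hx l
    rw [this]; ring
  rw [h4, h5] at h3
  simp only [smul_eq_mul] at h3
  linarith

theorem IsLocalMetric.pd_christoffelTrace (hG : IsLocalMetric G U) (hx : x ∈ U) (i k : Fin n) :
    pd k (christoffelTrace G i) x = -∑ j, pd k (pd j (fun y => (G y)⁻¹ i j)) x
      - ∑ j, (pd k (fun y => (G y)⁻¹ i j) x * logDensityDeriv G j x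
        + (G x)⁻¹ i j * pd k (logDensityDeriv G j) x) := by
  have ho := hG.isOpen
  have hs := fun a => (hG.smooth_logDensityDeriv a).differentiableAt_of_isOpen ho hx
  have hP := fun a b => (hG.smooth_inv a b).differentiableAt_of_isOpen ho hx
  have hdP := fun c a b => ((hG.smooth_inv a b).pd ho c).differentiableAt_of_isOpen ho hx
  rw [pd_congr ho (fun y hy => hG.christoffelTrace_eq hy i) hx, pd,
    fderiv_sub_apply (DifferentiableAt.fun_sum fun j _ => hdP j i j).fun_neg
      (.fun_sum fun j _ => (hP i j).fun_mul (hs j)),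
    fderiv_neg_apply, fderiv_sum_apply fun j => hdP j i j,
    fderiv_sum_apply fun j => (hP i j).fun_mul (hs j)]
  simp only [fderiv_mul_apply (hP i _) (hs _)]
  rfl

/-- The linear algebra behind `IsLocalConformal.lieDeriv_christoffelTrace`. -/
theorem lieDeriv_trace_algebra (i : Fin n) (P : Fin n → Fin n → ℝ) (dP : Fin n → Fin n → Fin n → ℝ)
    (ddP : Fin n → Fin n → ℝ) (σ : Fin n → ℝ) (dσ : Fin n → Fin n → ℝ) (z : E n)
    (D : Fin n → Fin n → ℝ) (DD : Fin n → Fin n → Fin n → ℝ) (c : ℝ) (dc : Fin n → ℝ)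
    (hDD : ∀ a b c, DD a b c = DD b a c)
    (hA : ∀ j, ∑ k, D j k * dP k i j + ∑ k, z k * ddP k j =
      ∑ a, dP j i a * D a j + ∑ a, P i a * DD j a j + ∑ a, dP j a j * D a i
        + ∑ a, P a j * DD j a i - 2 * (dc j * P i j + c * dP j i j))
    (hB : ∀ j, ∑ k, z k * dP k i j =
      ∑ a, P i a * D a j + ∑ a, P a j * D a i - 2 * (c * P i j))
    (hC : ∀ j, ∑ k, D j k * σ k + ∑ k, z k * dσ k j + ∑ k, DD j k k = n * dc j) :
    ∑ k, z k * (-∑ j, ddP k j - ∑ j, (dP k i j * σ j + P i j * dσ k j))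
      + ∑ j, ∑ k, P j k * DD k j i
      - ∑ j, (-∑ l, dP l j l - ∑ l, P j l * σ l) * D j i
      + 2 * c * (-∑ j, dP j i j - ∑ j, P i j * σ j) = (2 - n) * ∑ j, P i j * dc j := by
  have eA : ∑ k, z k * ∑ j, ddP k j = ∑ j, ∑ k, z k * ddP k j := by
    simp only [Finset.mul_sum]; exact Finset.sum_comm
  have eB : ∑ k, z k * ∑ j, dP k i j * σ j = ∑ j, (∑ k, z k * dP k i j) * σ j := by
    simp only [Finset.mul_sum, Finset.sum_mul, mul_assoc]; exact Finset.sum_comm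
  have eC : ∑ k, z k * ∑ j, P i j * dσ k j = ∑ j, P i j * ∑ k, z k * dσ k j := by
    simp only [Finset.mul_sum]; rw [Finset.sum_comm]
    exact Finset.sum_congr rfl fun _ _ => Finset.sum_congr rfl fun _ _ => by ring
  have hA' : ∀ j, ∑ k, z k * ddP k j = ∑ a, dP j i a * D a j + ∑ a, P i a * DD j a j
      + ∑ a, dP j a j * D a i + ∑ a, P a j * DD j a i - 2 * (dc j * P i j + c * dP j i j)
      - ∑ k, D j k * dP k i j := fun j => by rw [← hA j]; ring
  have hC' : ∀ j, ∑ k, z k * dσ k j = n * dc j - ∑ k, D j k * σ k - ∑ k, DD j k k :=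
    fun j => by rw [← hC j]; ring
  have split : ∑ k, z k * (-∑ j, ddP k j - ∑ j, (dP k i j * σ j + P i j * dσ k j)) =
      -∑ k, z k * ∑ j, ddP k j - ∑ k, z k * ∑ j, dP k i j * σ j
        - ∑ k, z k * ∑ j, P i j * dσ k j := by
    simp only [Finset.sum_add_distrib, mul_sub, mul_add, mul_neg, Finset.sum_sub_distrib,
      Finset.sum_neg_distrib]
    ring
  have e1 : ∑ j, ∑ a, dP j i a * D a j = ∑ j, ∑ k, D j k * dP k i j := by
    rw [Finset.sum_comm]
    exact Finset.sum_congr rfl fun _ _ => Finset.sum_congr rfl fun _ _ => by ring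
  have e2 : ∑ j, ∑ a, P i a * DD j a j = ∑ j, P i j * ∑ k, DD j k k := by
    rw [Finset.sum_comm]
    simp only [Finset.mul_sum]
    exact Finset.sum_congr rfl fun _ _ => Finset.sum_congr rfl fun _ _ => by rw [hDD]
  have e3 : ∑ j, ∑ a, dP j a j * D a i = ∑ j, (∑ l, dP l j l) * D j i := by
    rw [Finset.sum_comm]
    simp only [Finset.sum_mul]
  have e4 : ∑ j, ∑ a, P a j * DD j a i = ∑ j, ∑ k, P j k * DD k j i := Finset.sum_comm
  have e5 : ∑ j, (∑ a, P i a * D a j) * σ j = ∑ j, P i j * ∑ k, D j k * σ k := by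
    simp only [Finset.mul_sum, Finset.sum_mul, mul_assoc]; exact Finset.sum_comm
  have e6 : ∑ j, (∑ a, P a j * D a i) * σ j = ∑ j, (∑ l, P j l * σ l) * D j i := by
    simp only [Finset.sum_mul]; rw [Finset.sum_comm]
    exact Finset.sum_congr rfl fun _ _ => Finset.sum_congr rfl fun _ _ => by ring
  have e7 : ∑ j, dc j * P i j = ∑ j, P i j * dc j :=
    Finset.sum_congr rfl fun _ _ => mul_comm _ _
  -- The term `-2 g^{ij} ∂_j ψ` here and the term `n g^{ij} ∂_j ψ` of `tC` both enter the result
  -- with a minus sign, whence the constant `2 - n`. The gradient of the divergence of the field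
  -- cancels between the same two identities.
  have tA : ∑ j, ∑ k, z k * ddP k j = ∑ j, P i j * ∑ k, DD j k k
      + ∑ j, (∑ l, dP l j l) * D j i + ∑ j, ∑ k, P j k * DD k j i
      - 2 * ∑ j, P i j * dc j - 2 * c * ∑ j, dP j i j := by
    simp only [hA', Finset.sum_add_distrib, Finset.sum_sub_distrib, ← Finset.mul_sum, e1, e2, e3,
      e4, e7]
    ring
  have tB : ∑ j, (∑ k, z k * dP k i j) * σ j = ∑ j, P i j * ∑ k, D j k * σ k
      + ∑ j, (∑ l, P j l * σ l) * D j i - 2 * c * ∑ j, P i j * σ j := by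
    simp only [hB, add_mul, sub_mul, Finset.sum_add_distrib, Finset.sum_sub_distrib, e5, e6,
      mul_assoc, ← Finset.mul_sum]
  have tC : ∑ j, P i j * ∑ k, z k * dσ k j = n * ∑ j, P i j * dc j
      - ∑ j, P i j * ∑ k, D j k * σ k - ∑ j, P i j * ∑ k, DD j k k := by
    simp only [hC', mul_sub, Finset.sum_sub_distrib]
    congr 2
    rw [Finset.mul_sum]
    exact Finset.sum_congr rfl fun _ _ => by ring
  have tD : ∑ j, (-∑ l, dP l j l - ∑ l, P j l * σ l) * D j i =
      -∑ j, (∑ l, dP l j l) * D j i - ∑ j, (∑ l, P j l * σ l) * D j i := by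
    simp only [sub_mul, neg_mul, Finset.sum_sub_distrib, Finset.sum_neg_distrib]
  rw [split, eA, eB, eC, tA, tB, tC, tD]
  ring

/-- A conformal Killing field with conformal factor `ψ` on the open set `U`. -/
structure IsLocalConformal (G : E n → Matrix (Fin n) (Fin n) ℝ) (U : Set (E n)) (ζ : E n → E n)
    (ψ : E n → ℝ) : Prop where
  smooth_field (k : Fin n) : ContDiffOn ℝ ∞ (fun y => ζ y k) U
  smooth_factor : ContDiffOn ℝ ∞ ψ U
  lieDeriv_eq {y : E n} (hy : y ∈ U) : lieDerivMetric G ζ y = (2 * ψ y) • G y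

namespace IsLocalConformal

/-- The contravariant conformal equation in components. It holds on all of the open set `U`, so it
can be differentiated again. -/
theorem sum_mul_pd_inv (h : IsLocalConformal G U ζ ψ) (hG : IsLocalMetric G U) (hx : x ∈ U)
    (i j : Fin n) : ∑ k, ζ x k * pd k (fun y => (G y)⁻¹ i j) x =
      ∑ a, (G x)⁻¹ i a * pd a (fun y => ζ y j) x + ∑ a, (G x)⁻¹ a j * pd a (fun y => ζ y i) x
        - 2 * (ψ x * (G x)⁻¹ i j) := by
  have h1 := congrFun (congrFun
    ((hG.lieDerivMetric_eq_smul_iff hx _).1 (h.lieDeriv_eq hx)) i) j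
  rw [Matrix.sub_apply, Matrix.add_apply, Matrix.smul_apply, Matrix.mul_apply,
    Matrix.mul_apply] at h1
  simp only [dmat, jac, Matrix.of_apply, fderiv_apply_eq_sum_pd, Matrix.transpose_apply,
    smul_eq_mul, mul_assoc] at h1
  rw [h1]
  congr 2
  exact Finset.sum_congr rfl fun a _ => mul_comm _ _

theorem pd_sum_mul_pd_inv (h : IsLocalConformal G U ζ ψ) (hG : IsLocalMetric G U) (hx : x ∈ U)
    (i j l : Fin n) :
    ∑ k, pd l (fun y => ζ y k) x * pd k (fun y => (G y)⁻¹ i j) x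
      + ∑ k, ζ x k * pd k (pd l (fun y => (G y)⁻¹ i j)) x =
      ∑ a, pd l (fun y => (G y)⁻¹ i a) x * pd a (fun y => ζ y j) x
      + ∑ a, (G x)⁻¹ i a * pd l (pd a (fun y => ζ y j)) x
      + ∑ a, pd l (fun y => (G y)⁻¹ a j) x * pd a (fun y => ζ y i) x
      + ∑ a, (G x)⁻¹ a j * pd l (pd a (fun y => ζ y i)) x
      - 2 * (pd l ψ x * (G x)⁻¹ i j + ψ x * pd l (fun y => (G y)⁻¹ i j) x) := by
  have ho := hG.isOpen
  have hP := fun a b => (hG.smooth_inv a b).differentiableAt_of_isOpen ho hx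
  have hdP := fun c a b => ((hG.smooth_inv a b).pd ho c).differentiableAt_of_isOpen ho hx
  have hz := fun a => (h.smooth_field a).differentiableAt_of_isOpen ho hx
  have hdz := fun c a => ((h.smooth_field a).pd ho c).differentiableAt_of_isOpen ho hx
  have hψ := h.smooth_factor.differentiableAt_of_isOpen ho hx
  have h1 := pd_congr ho (fun y hy => h.sum_mul_pd_inv hG hy i j) hx l
  rw [pd, pd, fderiv_sum_apply fun k => (hz k).fun_mul (hdP k i j),
    fderiv_sub_apply ((DifferentiableAt.fun_sum fun a _ => (hP i a).fun_mul (hdz a j)).fun_add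
      (.fun_sum fun a _ => (hP a j).fun_mul (hdz a i))) ((hψ.fun_mul (hP i j)).const_mul 2),
    fderiv_add_apply (DifferentiableAt.fun_sum fun a _ => (hP i a).fun_mul (hdz a j))
      (.fun_sum fun a _ => (hP a j).fun_mul (hdz a i)),
    fderiv_sum_apply fun a => (hP i a).fun_mul (hdz a j),
    fderiv_sum_apply fun a => (hP a j).fun_mul (hdz a i),
    fderiv_const_mul_apply (hψ.fun_mul (hP i j)), fderiv_mul_apply hψ (hP i j)] at h1
  simp only [fderiv_mul_apply (hz _) (hdP _ i j), fderiv_mul_apply (hP i _) (hdz _ j),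
    fderiv_mul_apply (hP _ j) (hdz _ i), Finset.sum_add_distrib] at h1
  have h2 : ∀ k, pd k (pd l (fun y => (G y)⁻¹ i j)) x = pd l (pd k (fun y => (G y)⁻¹ i j)) x :=
    fun k => pd_comm (hG.smooth_inv i j) ho hx k l
  simp only [h2]
  simp only [pd] at h1 ⊢
  linarith

theorem pd_divergence (h : IsLocalConformal G U ζ ψ) (hG : IsLocalMetric G U) (hx : x ∈ U)
    (l : Fin n) :
    ∑ k, pd l (fun y => ζ y k) x * logDensityDeriv G k x
      + ∑ k, ζ x k * pd k (logDensityDeriv G l) x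
      + ∑ k, pd l (pd k (fun y => ζ y k)) x = n * pd l ψ x := by
  have ho := hG.isOpen
  have hs := fun a => (hG.smooth_logDensityDeriv a).differentiableAt_of_isOpen ho hx
  have hz := fun a => (h.smooth_field a).differentiableAt_of_isOpen ho hx
  have hdz := fun c a => ((h.smooth_field a).pd ho c).differentiableAt_of_isOpen ho hx
  have hψ := h.smooth_factor.differentiableAt_of_isOpen ho hx
  have h1 : EqOn (fun y => ∑ k, ζ y k * logDensityDeriv G k y + ∑ k, pd k (fun y => ζ y k) y)
      (fun y => n * ψ y) U := fun y hy => by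
    have := hG.divergence_eq hy (h.lieDeriv_eq hy)
    simp only
    linarith
  have h2 := pd_congr ho h1 hx l
  rw [pd, pd, fderiv_const_mul_apply hψ,
    fderiv_add_apply (.fun_sum fun k _ => (hz k).fun_mul (hs k)) (.fun_sum fun k _ => hdz k k),
    fderiv_sum_apply fun k => (hz k).fun_mul (hs k), fderiv_sum_apply fun k => hdz k k] at h2
  simp only [fderiv_mul_apply (hz _) (hs _), Finset.sum_add_distrib] at h2
  -- Closedness of `σ` replaces `∂_k σ_l` by `∂_l σ_k`, the derivative that arises from
  -- differentiating `ζᵏ σ_k`.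
  simp only [fun k => hG.pd_logDensityDeriv_comm hx k l]
  simp only [pd] at h2 ⊢
  linarith

/-- The contracted Lie derivative of the Levi-Civita connection along a conformal Killing field. -/
theorem lieDeriv_christoffelTrace (h : IsLocalConformal G U ζ ψ) (hG : IsLocalMetric G U)
    (hx : x ∈ U) (i : Fin n) :
    ∑ k, ζ x k * pd k (christoffelTrace G i) x
      + ∑ j, ∑ k, (G x)⁻¹ j k * pd k (pd j (fun y => ζ y i)) x
      - ∑ j, christoffelTrace G j x * pd j (fun y => ζ y i) x
      + 2 * ψ x * christoffelTrace G i x = (2 - n) * ∑ j, (G x)⁻¹ i j * pd j ψ x := by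
  have ho := hG.isOpen
  have hA := fun j => h.pd_sum_mul_pd_inv hG hx i j j
  have hB := fun j => h.sum_mul_pd_inv hG hx i j
  have hC := fun j => h.pd_divergence hG hx j
  have hcz : ∀ a b c, pd a (pd b (fun y => ζ y c)) x = pd b (pd a (fun y => ζ y c)) x :=
    fun a b c => pd_comm (h.smooth_field c) ho hx a b
  have hΓ := fun j => hG.christoffelTrace_eq hx j
  have hdΓ := fun k => hG.pd_christoffelTrace hx i k
  simp only [hdΓ, hΓ]
  generalize christoffelTrace G = Γ at *
  refine lieDeriv_trace_algebra i (fun a b => (G x)⁻¹ a b)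
    (fun l a b => pd l (fun y => (G y)⁻¹ a b) x)
    (fun l j => pd l (pd j (fun y => (G y)⁻¹ i j)) x)
    (fun j => logDensityDeriv G j x) (fun k j => pd k (logDensityDeriv G j) x) (ζ x)
    (fun a b => pd a (fun y => ζ y b) x) (fun a b c => pd a (pd b (fun y => ζ y c)) x)
    (ψ x) (fun j => pd j ψ x) hcz hA hB hC

end IsLocalConformal

end LocalConformal

/-! ### Expansion of the prolongation -/

section Prolongation

variable {n : ℕ}

/-- The partial derivative `∂F/∂xⁱ` of a function of `(x, u)`. -/
noncomputable def dx (i : Fin n) (F : E n × ℝ → ℝ) (p : E n × ℝ) : ℝ := fderiv ℝ F p (e i, 0)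

/-- The partial derivative `∂F/∂u` of a function of `(x, u)`. -/
noncomputable def du (F : E n × ℝ → ℝ) (p : E n × ℝ) : ℝ := fderiv ℝ F p (0, 1)

theorem fderiv_prod_apply (F : E n × ℝ → ℝ) (p : E n × ℝ) (i : Fin n) (s : ℝ) :
    fderiv ℝ F p (e i, s) = dx i F p + s * du F p := by
  have : ((e i, s) : E n × ℝ) = (e i, 0) + s • (0, 1) := by simp
  rw [this, map_add, map_smul]; rfl

theorem fderiv_prod_apply' (F : E n × ℝ → ℝ) (p : E n × ℝ) (v : E n) (s : ℝ) :
    fderiv ℝ F p (v, s) = ∑ k, v k * dx k F p + s * du F p := by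
  have : ((v, s) : E n × ℝ) = ∑ k, v k • ((e k, 0) : E n × ℝ) + s • (0, 1) := by
    refine Prod.ext ?_ ?_
    · simp [Prod.fst_sum, sum_smul_e]
    · simp [Prod.snd_sum]
  rw [this, map_add, map_smul, map_sum]
  simp only [map_smul]
  rfl

theorem totalDeriv1_eq (i : Fin n) (F : E n × ℝ → ℝ) (z : Jet1 n) :
    totalDeriv1 i F z = dx i F (z.1, z.2.1) + z.2.2 i * du F (z.1, z.2.1) :=
  fderiv_prod_apply _ _ _ _

theorem prolong1_eq (ξ : E n × ℝ → E n) (η : E n × ℝ → ℝ) (i : Fin n) (z : Jet1 n) :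
    prolong1 ξ η i z = dx i η (z.1, z.2.1) + z.2.2 i * du η (z.1, z.2.1)
      - ∑ k, z.2.2 k * (dx i (fun p => ξ p k) (z.1, z.2.1)
        + z.2.2 i * du (fun p => ξ p k) (z.1, z.2.1)) := by
  simp only [prolong1, totalDeriv1_eq]

section

variable {S : Set (E n × ℝ)} {F : E n × ℝ → ℝ} {x : E n} {u : ℝ}

theorem _root_.ContDiffOn.dx (hF : ContDiffOn ℝ ∞ F S) (hS : IsOpen S) (i : Fin n) :
    ContDiffOn ℝ ∞ (PoissonSymmetry.dx i F) S :=
  hF.fderiv_apply_of_isOpen hS _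

theorem _root_.ContDiffOn.du (hF : ContDiffOn ℝ ∞ F S) (hS : IsOpen S) :
    ContDiffOn ℝ ∞ (PoissonSymmetry.du F) S :=
  hF.fderiv_apply_of_isOpen hS _

theorem hasFDerivAt_comp_jet1 {z : Jet1 n} (hF : DifferentiableAt ℝ F (z.1, z.2.1)) :
    HasFDerivAt (fun w : Jet1 n => F (w.1, w.2.1))
      ((fderiv ℝ F (z.1, z.2.1)).comp ((ContinuousLinearMap.fst ℝ (E n) (ℝ × (Fin n → ℝ))).prod
        ((ContinuousLinearMap.fst ℝ ℝ (Fin n → ℝ)).comp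
          (ContinuousLinearMap.snd ℝ (E n) (ℝ × (Fin n → ℝ)))))) z := by
  exact HasFDerivAt.comp (f := fun w : Jet1 n => (w.1, w.2.1)) z hF.hasFDerivAt
    (ContinuousLinearMap.hasFDerivAt ((ContinuousLinearMap.fst ℝ (E n) (ℝ × (Fin n → ℝ))).prod
      ((ContinuousLinearMap.fst ℝ ℝ (Fin n → ℝ)).comp
        (ContinuousLinearMap.snd ℝ (E n) (ℝ × (Fin n → ℝ))))))

theorem hasFDerivAt_jet1_coord (z : Jet1 n) (i : Fin n) :
    HasFDerivAt (fun w : Jet1 n => w.2.2 i)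
      ((ContinuousLinearMap.proj i).comp ((ContinuousLinearMap.snd ℝ ℝ (Fin n → ℝ)).comp
        (ContinuousLinearMap.snd ℝ (E n) (ℝ × (Fin n → ℝ)))) : Jet1 n →L[ℝ] ℝ) z :=
  ContinuousLinearMap.hasFDerivAt
    ((ContinuousLinearMap.proj i).comp ((ContinuousLinearMap.snd ℝ ℝ (Fin n → ℝ)).comp
        (ContinuousLinearMap.snd ℝ (E n) (ℝ × (Fin n → ℝ)))) : Jet1 n →L[ℝ] ℝ)

theorem fderiv_comp_jet1 {z : Jet1 n} (hF : DifferentiableAt ℝ F (z.1, z.2.1)) (j : Fin n) (s : ℝ)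
    (r : Fin n → ℝ) : fderiv ℝ (fun w : Jet1 n => F (w.1, w.2.1)) z (e j, s, r) =
      dx j F (z.1, z.2.1) + s * du F (z.1, z.2.1) := by
  rw [(hasFDerivAt_comp_jet1 hF).fderiv, ← fderiv_prod_apply]
  rfl

theorem fderiv_jet1_coord (z : Jet1 n) (i : Fin n) (v : Jet1 n) :
    fderiv ℝ (fun w : Jet1 n => w.2.2 i) z v = v.2.2 i := by
  rw [(hasFDerivAt_jet1_coord z i).fderiv]
  rfl

/-- The product rule applied to `η_[i]`. The symmetry of `q` is not used here, so `q j i` and `q i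
k` keep the index order in which the total derivatives produce them. -/
theorem prolong2_eq (hS : IsOpen S) {ξ : E n × ℝ → E n} {η : E n × ℝ → ℝ}
    (hξ : ∀ k, ContDiffOn ℝ ∞ (fun p => ξ p k) S) (hη : ContDiffOn ℝ ∞ η S)
    (hx : (x, u) ∈ S) (p : Fin n → ℝ) (q : Fin n → Fin n → ℝ) (i j : Fin n) :
    prolong2 ξ η i j (x, u, p, q) =
      dx j (dx i η) (x, u) + p j * du (dx i η) (x, u)
        + (q j i * du η (x, u) + p i * (dx j (du η) (x, u) + p j * du (du η) (x, u)))
      - ∑ k, (q j k * (dx i (fun s => ξ s k) (x, u) + p i * du (fun s => ξ s k) (x, u))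
        + p k * (dx j (dx i (fun s => ξ s k)) (x, u) + p j * du (dx i (fun s => ξ s k)) (x, u)
          + (q j i * du (fun s => ξ s k) (x, u) + p i * (dx j (du (fun s => ξ s k)) (x, u)
            + p j * du (du (fun s => ξ s k)) (x, u)))))
      - ∑ k, q i k * (dx j (fun s => ξ s k) (x, u) + p j * du (fun s => ξ s k) (x, u)) := by
  have h1 : prolong1 ξ η i = fun z : Jet1 n => dx i η (z.1, z.2.1) + z.2.2 i * du η (z.1, z.2.1)
      - ∑ k, z.2.2 k * (dx i (fun p => ξ p k) (z.1, z.2.1)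
        + z.2.2 i * du (fun p => ξ p k) (z.1, z.2.1)) := funext fun z => prolong1_eq ξ η i z
  set z : Jet1 n := (x, u, p) with hz
  have d1 := ((hη.dx hS i).differentiableAt_of_isOpen hS hx)
  have d2 := ((hη.du hS).differentiableAt_of_isOpen hS hx)
  have d3 := fun k => (((hξ k).dx hS i).differentiableAt_of_isOpen hS hx)
  have d4 := fun k => (((hξ k).du hS).differentiableAt_of_isOpen hS hx)
  have c1 := (hasFDerivAt_comp_jet1 (z := z) d1).differentiableAt
  have c2 := (hasFDerivAt_comp_jet1 (z := z) d2).differentiableAt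
  have c3 := fun k => (hasFDerivAt_comp_jet1 (z := z) (d3 k)).differentiableAt
  have c4 := fun k => (hasFDerivAt_comp_jet1 (z := z) (d4 k)).differentiableAt
  have c0 := fun k => (hasFDerivAt_jet1_coord z k).differentiableAt
  have c5 := fun k => (c3 k).fun_add ((c0 i).fun_mul (c4 k))
  have h2 : totalDeriv2 j (prolong1 ξ η i) (x, u, p, q) =
      fderiv ℝ (prolong1 ξ η i) z (e j, p j, q j) := rfl
  rw [prolong2, h2, h1, fderiv_sub_apply (c1.fun_add ((c0 i).fun_mul c2))
    (.fun_sum fun k _ => (c0 k).fun_mul (c5 k)), fderiv_add_apply c1 ((c0 i).fun_mul c2),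
    fderiv_mul_apply (c0 i) c2, fderiv_sum_apply fun k => (c0 k).fun_mul (c5 k)]
  simp only [fderiv_mul_apply (c0 _) (c5 _), fderiv_add_apply (c3 _) ((c0 i).fun_mul (c4 _)),
    fderiv_mul_apply (c0 i) (c4 _), fderiv_jet1_coord, totalDeriv1_eq]
  rw [fderiv_comp_jet1 (z := z) d1, fderiv_comp_jet1 (z := z) d2]
  simp only [fun k => fderiv_comp_jet1 (z := z) (d3 k) j (p j) (q j),
    fun k => fderiv_comp_jet1 (z := z) (d4 k) j (p j) (q j)]
  rfl

end

/-! ### The differential of the Poisson function on jets -/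

section

variable {G : E n → Matrix (Fin n) (Fin n) ℝ} {U : Set (E n)} {F : E n × ℝ → ℝ} {x : E n} {u : ℝ}

theorem fderiv_comp_fst {W : Type*} [NormedAddCommGroup W] [NormedSpace ℝ W] {f : E n → ℝ}
    {z : E n × W} (hf : DifferentiableAt ℝ f z.1) (v : E n × W) :
    DifferentiableAt ℝ (fun w : E n × W => f w.1) z ∧
      fderiv ℝ (fun w : E n × W => f w.1) z v = fderiv ℝ f z.1 v.1 := by
  have h : HasFDerivAt (fun w : E n × W => f w.1)
      ((fderiv ℝ f z.1).comp (ContinuousLinearMap.fst ℝ (E n) W)) z :=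
    HasFDerivAt.comp z hf.hasFDerivAt (ContinuousLinearMap.fst ℝ (E n) W).hasFDerivAt
  exact ⟨h.differentiableAt, by rw [h.fderiv]; rfl⟩

theorem fderiv_continuousLinearMap {W : Type*} [NormedAddCommGroup W] [NormedSpace ℝ W]
    (L : W →L[ℝ] ℝ) (z v : W) :
    DifferentiableAt ℝ (fun w => L w) z ∧ fderiv ℝ (fun w => L w) z v = L v :=
  ⟨L.differentiableAt, by rw [L.fderiv]⟩

theorem fderiv_jet2_fst (z v : Jet2 n) (i : Fin n) :
    DifferentiableAt ℝ (fun w : Jet2 n => w.2.2.1 i) z ∧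
      fderiv ℝ (fun w : Jet2 n => w.2.2.1 i) z v = v.2.2.1 i :=
  fderiv_continuousLinearMap ((ContinuousLinearMap.proj i).comp
    ((ContinuousLinearMap.fst ℝ (Fin n → ℝ) (Fin n → Fin n → ℝ)).comp
    ((ContinuousLinearMap.snd ℝ ℝ _).comp (ContinuousLinearMap.snd ℝ (E n) _)))) z v

theorem fderiv_jet2_snd (z v : Jet2 n) (i j : Fin n) :
    DifferentiableAt ℝ (fun w : Jet2 n => w.2.2.2 i j) z ∧
      fderiv ℝ (fun w : Jet2 n => w.2.2.2 i j) z v = v.2.2.2 i j :=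
  fderiv_continuousLinearMap ((ContinuousLinearMap.proj j).comp ((ContinuousLinearMap.proj
    (R := ℝ) (φ := fun _ : Fin n => Fin n → ℝ) i).comp
    ((ContinuousLinearMap.snd ℝ (Fin n → ℝ) (Fin n → Fin n → ℝ)).comp
    ((ContinuousLinearMap.snd ℝ ℝ _).comp (ContinuousLinearMap.snd ℝ (E n) _))))) z v

theorem fderiv_comp_jet2 {z : Jet2 n} (hF : DifferentiableAt ℝ F (z.1, z.2.1)) (v : Jet2 n) :
    DifferentiableAt ℝ (fun w : Jet2 n => F (w.1, w.2.1)) z ∧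
      fderiv ℝ (fun w : Jet2 n => F (w.1, w.2.1)) z v = fderiv ℝ F (z.1, z.2.1) (v.1, v.2.1) := by
  let L : Jet2 n →L[ℝ] E n × ℝ := (ContinuousLinearMap.fst ℝ (E n) _).prod
    ((ContinuousLinearMap.fst ℝ ℝ _).comp (ContinuousLinearMap.snd ℝ (E n) _))
  have h : HasFDerivAt (fun w : Jet2 n => F (w.1, w.2.1))
      ((fderiv ℝ F (z.1, z.2.1)).comp L) z :=
    HasFDerivAt.comp (f := fun w : Jet2 n => (w.1, w.2.1)) z hF.hasFDerivAt L.hasFDerivAt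
  exact ⟨h.differentiableAt, by rw [h.fderiv]; rfl⟩

theorem fderiv_poissonFunction (hG : IsLocalMetric G U) {z : Jet2 n} (hx : z.1 ∈ U)
    (hF : DifferentiableAt ℝ F (z.1, z.2.1)) (v : Jet2 n) :
    fderiv ℝ (poissonFunction G F) z v =
      ∑ i, ∑ j, (fderiv ℝ (fun y => (G y)⁻¹ i j) z.1 v.1 * z.2.2.2 i j
        + (G z.1)⁻¹ i j * v.2.2.2 i j)
      - ∑ i, (fderiv ℝ (christoffelTrace G i) z.1 v.1 * z.2.2.1 i
        + christoffelTrace G i z.1 * v.2.2.1 i)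
      - fderiv ℝ F (z.1, z.2.1) (v.1, v.2.1) := by
  have hP := fun i j => fderiv_comp_fst (W := ℝ × (Fin n → ℝ) × (Fin n → Fin n → ℝ)) (z := z)
    ((hG.smooth_inv i j).differentiableAt_of_isOpen hG.isOpen hx) v
  have hΓ := fun i => fderiv_comp_fst (W := ℝ × (Fin n → ℝ) × (Fin n → Fin n → ℝ)) (z := z)
    ((hG.smooth_christoffelTrace i).differentiableAt_of_isOpen hG.isOpen hx) v
  have hp := fun i => fderiv_jet2_fst z v i
  have hq := fun i j => fderiv_jet2_snd z v i j
  have hf := fderiv_comp_jet2 hF v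
  have h1 : poissonFunction G F = fun w : Jet2 n => ∑ i, ∑ j, (G w.1)⁻¹ i j * w.2.2.2 i j
    - ∑ i, christoffelTrace G i w.1 * w.2.2.1 i - F (w.1, w.2.1) := rfl
  have a1 : ∀ i j, DifferentiableAt ℝ (fun w : Jet2 n => (G w.1)⁻¹ i j * w.2.2.2 i j) z :=
    fun i j => (hP i j).1.fun_mul (hq i j).1
  have a2 : ∀ i, DifferentiableAt ℝ (fun w : Jet2 n => christoffelTrace G i w.1 * w.2.2.1 i) z :=
    fun i => (hΓ i).1.fun_mul (hp i).1
  have a3 : ∀ i, DifferentiableAt ℝ (fun w : Jet2 n => ∑ j, (G w.1)⁻¹ i j * w.2.2.2 i j) z :=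
    fun i => .fun_sum fun j _ => a1 i j
  rw [h1, fderiv_sub_apply ((DifferentiableAt.fun_sum fun i _ => a3 i).fun_sub
      (.fun_sum fun i _ => a2 i)) hf.1,
    fderiv_sub_apply (.fun_sum fun i _ => a3 i) (.fun_sum fun i _ => a2 i),
    fderiv_sum_apply a3, fderiv_sum_apply a2, hf.2]
  congr 2
  · refine Finset.sum_congr rfl fun i _ => ?_
    rw [fderiv_sum_apply (a1 i)]
    refine Finset.sum_congr rfl fun j _ => ?_
    rw [fderiv_mul_apply (hP i j).1 (hq i j).1, (hP i j).2, (hq i j).2]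
  · refine Finset.sum_congr rfl fun i _ => ?_
    rw [fderiv_mul_apply (hΓ i).1 (hp i).1, (hΓ i).2, (hp i).2]

end

end Prolongation

/-! ### The determining equations at a point -/

section Determining

variable {n : ℕ} {G : E n → Matrix (Fin n) (Fin n) ℝ} {U : Set (E n)} {J : Set ℝ}
  {F : E n × ℝ → ℝ} {ξ : E n × ℝ → E n} {η : E n × ℝ → ℝ} {x : E n} {u : ℝ}

/-- The coefficients of `u_{ij}` in `X^[2] H`. -/
noncomputable def hessCoeff (G : E n → Matrix (Fin n) (Fin n) ℝ) (ξ : E n × ℝ → E n)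
    (η : E n × ℝ → ℝ) (x : E n) (u : ℝ) (p : Fin n → ℝ) (i j : Fin n) : ℝ :=
  fderiv ℝ (fun y => (G y)⁻¹ i j) x (ξ (x, u))
    + (G x)⁻¹ i j * (du η (x, u) - ∑ k, p k * du (fun s => ξ s k) (x, u))
    - 2 * ∑ b, (G x)⁻¹ i b * (dx b (fun s => ξ s j) (x, u) + p b * du (fun s => ξ s j) (x, u))

/-- The part of `X^[2] H` that does not depend on `u_{ij}`. -/
noncomputable def hessFreePart (G : E n → Matrix (Fin n) (Fin n) ℝ) (F : E n × ℝ → ℝ)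
    (ξ : E n × ℝ → E n) (η : E n × ℝ → ℝ) (x : E n) (u : ℝ) (p : Fin n → ℝ) : ℝ :=
  ∑ i, ∑ j, (G x)⁻¹ i j * (dx j (dx i η) (x, u) + p j * du (dx i η) (x, u)
      + p i * (dx j (du η) (x, u) + p j * du (du η) (x, u))
      - ∑ k, p k * (dx j (dx i (fun s => ξ s k)) (x, u) + p j * du (dx i (fun s => ξ s k)) (x, u)
        + p i * (dx j (du (fun s => ξ s k)) (x, u) + p j * du (du (fun s => ξ s k)) (x, u))))
    - ∑ i, (fderiv ℝ (christoffelTrace G i) x (ξ (x, u)) * p i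
        + christoffelTrace G i x * prolong1 ξ η i (x, u, p))
    - fderiv ℝ F (x, u) (ξ (x, u), η (x, u))

/-- The terms `u_{jk} D_i ξᵏ` and `u_{ik} D_j ξᵏ` have the same contraction with the symmetric
`g^{ij}`, which explains the factor 2 in `hessCoeff`. Here `w`, `D` and `h` stand for `∂ξ/∂u`,
`∂ξ/∂x` and `η_u`; `A` and `B` collect the parts free of `u_{ij}`. -/
theorem sum_hess_algebra (P : Fin n → Fin n → ℝ) (q : Fin n → Fin n → ℝ)
    (hP : ∀ i j, P i j = P j i) (hq : ∀ i j, q i j = q j i) (p w : Fin n → ℝ)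
    (D : Fin n → Fin n → ℝ) (h : ℝ) (dP A : Fin n → Fin n → ℝ) (B : Fin n → Fin n → Fin n → ℝ) :
    ∑ i, ∑ j, (dP i j * q i j + P i j * (A i j + q j i * h
      - ∑ k, (q j k * (D i k + p i * w k) + (p k * (B i j k + q j i * w k)))
      - ∑ k, q i k * (D j k + p j * w k))) =
    ∑ i, ∑ j, (dP i j + P i j * (h - ∑ k, p k * w k) - 2 * ∑ b, P i b * (D b j + p b * w j)) * q i j
      + ∑ i, ∑ j, P i j * (A i j - ∑ k, p k * B i j k) := by
  have e1 : ∑ i, ∑ j, P i j * ∑ k, q j k * (D i k + p i * w k) =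
      ∑ i, ∑ j, (∑ b, P i b * (D b j + p b * w j)) * q i j := by
    rw [Finset.sum_comm]
    refine Finset.sum_congr rfl fun i _ => ?_
    simp only [Finset.mul_sum, Finset.sum_mul]
    rw [Finset.sum_comm]
    refine Finset.sum_congr rfl fun j _ => Finset.sum_congr rfl fun b _ => ?_
    rw [hP i b]; ring
  have e2 : ∑ i, ∑ j, P i j * ∑ k, q i k * (D j k + p j * w k) =
      ∑ i, ∑ j, (∑ b, P i b * (D b j + p b * w j)) * q i j := by
    refine Finset.sum_congr rfl fun i _ => ?_
    simp only [Finset.mul_sum, Finset.sum_mul]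
    rw [Finset.sum_comm]
    refine Finset.sum_congr rfl fun j _ => Finset.sum_congr rfl fun b _ => ?_
    ring
  have l : ∀ i j, dP i j * q i j + P i j * (A i j + q j i * h
      - ∑ k, (q j k * (D i k + p i * w k) + (p k * (B i j k + q j i * w k)))
      - ∑ k, q i k * (D j k + p j * w k)) = (dP i j + P i j * (h - ∑ k, p k * w k)) * q i j
      - P i j * ∑ k, q j k * (D i k + p i * w k) - P i j * ∑ k, q i k * (D j k + p j * w k)
      + P i j * (A i j - ∑ k, p k * B i j k) := by
    intro i j
    have : ∑ k, p k * (B i j k + q j i * w k) = ∑ k, p k * B i j k + q i j * ∑ k, p k * w k := by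
      rw [Finset.mul_sum, ← Finset.sum_add_distrib]
      exact Finset.sum_congr rfl fun k _ => by rw [hq i j]; ring
    rw [Finset.sum_add_distrib, this, hq j i]
    ring
  have r : ∀ i j, (dP i j + P i j * (h - ∑ k, p k * w k)
      - 2 * ∑ b, P i b * (D b j + p b * w j)) * q i j =
      (dP i j + P i j * (h - ∑ k, p k * w k)) * q i j
        - 2 * ((∑ b, P i b * (D b j + p b * w j)) * q i j) := fun i j => by ring
  simp only [l, r]
  simp only [Finset.sum_add_distrib, Finset.sum_sub_distrib, e1, e2, ← Finset.mul_sum]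
  ring

/-- Second derivatives enter `η_[ij]` only to first order, so `X^[2] H` is affine in them and the
hyperplane argument applies. -/
theorem fderiv_poissonFunction_prolongation (hG : IsLocalMetric G U) (hJ : IsOpen J)
    (hF : ContDiffOn ℝ ∞ F (U ×ˢ J)) (hξ : ∀ k, ContDiffOn ℝ ∞ (fun p => ξ p k) (U ×ˢ J))
    (hη : ContDiffOn ℝ ∞ η (U ×ˢ J)) (hx : x ∈ U) (hu : u ∈ J) (p : Fin n → ℝ)
    {q : Fin n → Fin n → ℝ} (hq : ∀ i j, q i j = q j i) :
    fderiv ℝ (poissonFunction G F) (x, u, p, q) (prolongation ξ η (x, u, p, q)) =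
      ∑ i, ∑ j, hessCoeff G ξ η x u p i j * q i j + hessFreePart G F ξ η x u p := by
  have hS : IsOpen (U ×ˢ J) := hG.isOpen.prod hJ
  have hxu : (x, u) ∈ U ×ˢ J := ⟨hx, hu⟩
  rw [fderiv_poissonFunction hG (z := (x, u, p, q)) hx (hF.differentiableAt_of_isOpen hS hxu)]
  simp only [prolongation, prolong2_eq hS hξ hη hxu, Jet2.toJet1]
  have key := sum_hess_algebra (fun i j => (G x)⁻¹ i j) q (hG.inv_symm hx) hq p
    (fun k => du (fun s => ξ s k) (x, u)) (fun b j => dx b (fun s => ξ s j) (x, u)) (du η (x, u))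
    (fun i j => fderiv ℝ (fun y => (G y)⁻¹ i j) x (ξ (x, u)))
    (fun i j => dx j (dx i η) (x, u) + p j * du (dx i η) (x, u)
      + p i * (dx j (du η) (x, u) + p j * du (du η) (x, u)))
    (fun i j k => dx j (dx i (fun s => ξ s k)) (x, u) + p j * du (dx i (fun s => ξ s k)) (x, u)
        + p i * (dx j (du (fun s => ξ s k)) (x, u) + p j * du (du (fun s => ξ s k)) (x, u)))
  simp only [hessCoeff, hessFreePart]
  rw [← add_sub_assoc, ← add_sub_assoc, ← key]
  congr 2
  refine Finset.sum_congr rfl fun i _ => Finset.sum_congr rfl fun j _ => ?_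
  congr 2
  congr 1
  congr 1
  · ring
  · exact Finset.sum_congr rfl fun k _ => by ring

/-- A linear functional on symmetric matrices that is constant on an affine hyperplane. -/
theorem symm_eq_of_hyperplane {P N : Fin n → Fin n → ℝ} {s c : ℝ} (hP : ∀ i j, P i j = P j i)
    (hP0 : ∃ i j, P i j ≠ 0)
    (h : ∀ q : Fin n → Fin n → ℝ, (∀ i j, q i j = q j i) → ∑ i, ∑ j, P i j * q i j = s →
      ∑ i, ∑ j, N i j * q i j + c = 0) :
    ∃ μ, (∀ i j, N i j + N j i = 2 * μ * P i j) ∧ c = -μ * s := by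
  -- The entrywise Euclidean product on matrices is used, so `a > 0` whatever the signature of the
  -- metric behind `P`.
  set a := ∑ i, ∑ j, P i j * P i j with ha
  have ha0 : a ≠ 0 := by
    obtain ⟨i, j, hij⟩ := hP0
    have h1 : 0 < P i j * P i j := mul_self_pos.2 hij
    have h2 : P i j * P i j ≤ ∑ j, P i j * P i j :=
      Finset.single_le_sum (f := fun j => P i j * P i j) (fun j _ => mul_self_nonneg _)
        (Finset.mem_univ j)
    have h3 : ∑ j, P i j * P i j ≤ a :=
      Finset.single_le_sum (f := fun i => ∑ j, P i j * P i j)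
        (fun i _ => Finset.sum_nonneg fun j _ => mul_self_nonneg _) (Finset.mem_univ i)
    linarith
  set b := ∑ i, ∑ j, N i j * P i j with hb
  -- `b / a` is the coefficient of the orthogonal projection of `N` on `P`, and will be `μ`. Thus
  -- `R` is twice the symmetric part of `N` with its component along `P` removed.
  set R : Fin n → Fin n → ℝ := fun i j => N i j + N j i - 2 * (b / a) * P i j with hR
  have lin : ∀ (A B C : Fin n → Fin n → ℝ) (t r : ℝ), ∑ i, ∑ j, A i j * (t * B i j + r * C i j) =
      t * ∑ i, ∑ j, A i j * B i j + r * ∑ i, ∑ j, A i j * C i j := by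
    intro A B C t r
    simp only [Finset.mul_sum, ← Finset.sum_add_distrib]
    exact Finset.sum_congr rfl fun _ _ => Finset.sum_congr rfl fun _ _ => by ring
  have hb' : ∑ i, ∑ j, P i j * N i j = b := by
    simp only [hb, mul_comm]
  have hbT : ∑ i, ∑ j, P i j * N j i = b := by
    rw [Finset.sum_comm, ← hb']
    exact Finset.sum_congr rfl fun _ _ => Finset.sum_congr rfl fun _ _ => by rw [hP]
  have hRs : ∀ i j, R i j = R j i := fun i j => by simp only [hR]; rw [hP i j]; ring
  have hPR : ∑ i, ∑ j, P i j * R i j = 0 := by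
    have : ∑ i, ∑ j, P i j * R i j = ∑ i, ∑ j, P i j * N i j + ∑ i, ∑ j, P i j * N j i
        - 2 * (b / a) * a := by
      rw [ha]
      simp only [hR, Finset.mul_sum, ← Finset.sum_add_distrib, ← Finset.sum_sub_distrib]
      exact Finset.sum_congr rfl fun _ _ => Finset.sum_congr rfl fun _ _ => by ring
    rw [this, hb', hbT]
    field_simp
    ring
  -- The matrix `(s / a) P` lies on the hyperplane, and adding `R ⊥ P` stays on it. The first test
  -- gives `c`; the difference of the two gives `⟨N, R⟩ = 0`, from which `⟨R, R⟩ = 0`.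
  have q0 := h (fun i j => s / a * P i j + 0 * R i j) (fun i j => by rw [hP i j, hRs i j])
    (by rw [lin, ← ha]; field_simp; ring)
  have q1 := h (fun i j => s / a * P i j + 1 * R i j) (fun i j => by rw [hP i j, hRs i j])
    (by rw [lin, ← ha, hPR]; field_simp; ring)
  rw [lin, ← hb] at q0 q1
  have hNR : ∑ i, ∑ j, N i j * R i j = 0 := by linarith
  have hNRT : ∑ i, ∑ j, N j i * R i j = 0 := by
    rw [Finset.sum_comm, ← hNR]
    exact Finset.sum_congr rfl fun _ _ => Finset.sum_congr rfl fun _ _ => by rw [hRs]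
  have hRR : ∑ i, ∑ j, R i j * R i j = 0 := by
    have : ∑ i, ∑ j, R i j * R i j = ∑ i, ∑ j, N i j * R i j + ∑ i, ∑ j, N j i * R i j
        - 2 * (b / a) * ∑ i, ∑ j, P i j * R i j := by
      simp only [Finset.mul_sum, ← Finset.sum_add_distrib, ← Finset.sum_sub_distrib]
      refine Finset.sum_congr rfl fun i _ => Finset.sum_congr rfl fun j _ => ?_
      simp only [hR]
      ring
    rw [this, hNR, hNRT, hPR]
    ring
  have hR0 : ∀ i j, R i j = 0 := by
    intro i j
    have h1 := (Finset.sum_eq_zero_iff_of_nonneg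
      (fun i _ => Finset.sum_nonneg fun j _ => mul_self_nonneg (R i j))).1 hRR i (Finset.mem_univ i)
    have h2 := (Finset.sum_eq_zero_iff_of_nonneg
      (fun j _ => mul_self_nonneg (R i j))).1 h1 j (Finset.mem_univ j)
    exact mul_self_eq_zero.1 h2
  refine ⟨b / a, fun i j => by have := hR0 i j; simp only [hR] at this; linarith, ?_⟩
  field_simp at q0 ⊢
  linarith

theorem IsLocalMetric.exists_inv_ne_zero (hG : IsLocalMetric G U) (hx : x ∈ U) (hn : 0 < n) :
    ∃ i j, (G x)⁻¹ i j ≠ 0 := by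
  by_contra! h0
  have h1 := Matrix.nonsing_inv_mul _ (hG.isUnit_det hx)
  have h2 : (G x)⁻¹ = 0 := Matrix.ext h0
  rw [h2, Matrix.zero_mul] at h1
  have h3 := congrFun (congrFun h1 ⟨0, hn⟩) ⟨0, hn⟩
  simp at h3

/-- The determining equations, before splitting them with respect to `u_i`. -/
theorem isLocalLieSymmetry_iff (hn : 0 < n) (hG : IsLocalMetric G U) (hJ : IsOpen J)
    (hF : ContDiffOn ℝ ∞ F (U ×ˢ J)) (hξ : ∀ k, ContDiffOn ℝ ∞ (fun p => ξ p k) (U ×ˢ J))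
    (hη : ContDiffOn ℝ ∞ η (U ×ˢ J)) :
    IsLocalLieSymmetry U J (poissonFunction G F) ξ η ↔
      ∃ μ : E n → ℝ → (Fin n → ℝ) → ℝ, ∀ x ∈ U, ∀ u ∈ J, ∀ p : Fin n → ℝ,
        (∀ i j, hessCoeff G ξ η x u p i j + hessCoeff G ξ η x u p j i
          = 2 * μ x u p * (G x)⁻¹ i j) ∧
        hessFreePart G F ξ η x u p = -μ x u p * (∑ i, christoffelTrace G i x * p i + F (x, u)) := by
  constructor
  · rintro ⟨lam, hlam⟩
    -- The conditions `x ∈ U` and `u ∈ J` stay inside the existential so that choice yields `μ` on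
    -- all first order jets; outside the domain the value `0` is arbitrary.
    have key : ∀ (x : E n) (u : ℝ) (p : Fin n → ℝ), ∃ μ : ℝ, x ∈ U → u ∈ J →
        (∀ i j, hessCoeff G ξ η x u p i j + hessCoeff G ξ η x u p j i
          = 2 * μ * (G x)⁻¹ i j) ∧
        hessFreePart G F ξ η x u p = -μ * (∑ i, christoffelTrace G i x * p i + F (x, u)) := by
      intro x u p
      by_cases hxu : x ∈ U ∧ u ∈ J
      · obtain ⟨hx, hu⟩ := hxu
        have hne := hG.exists_inv_ne_zero hx hn
        obtain ⟨μ, hμ⟩ := symm_eq_of_hyperplane (P := fun i j => (G x)⁻¹ i j)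
          (N := hessCoeff G ξ η x u p) (s := ∑ i, christoffelTrace G i x * p i + F (x, u))
          (c := hessFreePart G F ξ η x u p) (hG.inv_symm hx) hne (by
            intro q hq hs
            rw [← fderiv_poissonFunction_prolongation hG hJ hF hξ hη hx hu p hq,
              hlam x hx u hu p q hq]
            have : poissonFunction G F (x, u, p, q) = 0 := by
              simp only [poissonFunction, laplaceSymbol]
              rw [hs]
              ring
            rw [this, mul_zero])
        exact ⟨μ, fun _ _ => hμ⟩
      · exact ⟨0, fun hx hu => absurd ⟨hx, hu⟩ hxu⟩
    choose μ hμ using key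
    exact ⟨μ, fun x hx u hu p => hμ x u p hx hu⟩
  · rintro ⟨μ, hμ⟩
    refine ⟨fun z => μ z.1 z.2.1 z.2.2.1, fun x hx u hu p q hq => ?_⟩
    obtain ⟨h1, h2⟩ := hμ x hx u hu p
    rw [fderiv_poissonFunction_prolongation hG hJ hF hξ hη hx hu p hq, h2]
    -- Only the symmetrised coefficients are known, and they suffice because `q` is symmetric.
    have h3 : ∑ i, ∑ j, hessCoeff G ξ η x u p i j * q i j =
        ∑ i, ∑ j, hessCoeff G ξ η x u p j i * q i j := by
      rw [Finset.sum_comm]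
      exact Finset.sum_congr rfl fun _ _ => Finset.sum_congr rfl fun _ _ => by rw [hq]
    have h4 : ∑ i, ∑ j, hessCoeff G ξ η x u p i j * q i j =
        μ x u p * ∑ i, ∑ j, (G x)⁻¹ i j * q i j := by
      have : ∑ i, ∑ j, hessCoeff G ξ η x u p i j * q i j
          + ∑ i, ∑ j, hessCoeff G ξ η x u p j i * q i j =
          2 * (μ x u p * ∑ i, ∑ j, (G x)⁻¹ i j * q i j) := by
        simp only [Finset.mul_sum, ← Finset.sum_add_distrib]
        refine Finset.sum_congr rfl fun i _ => Finset.sum_congr rfl fun j _ => ?_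
        rw [← add_mul, h1]
        ring
      linarith
    rw [h4]
    simp only [poissonFunction, laplaceSymbol]
    ring

end Determining

/-! ### Splitting the determining equations -/

section Splitting

variable {n : ℕ} {G : E n → Matrix (Fin n) (Fin n) ℝ} {U : Set (E n)} {J : Set ℝ}
  {F : E n × ℝ → ℝ} {ξ : E n × ℝ → E n} {η : E n × ℝ → ℝ} {ζ : E n → E n} {x : E n} {u : ℝ}

/-- If `ν ≠ 0`, then `ν g⁻¹` has rank `n ≥ 2`, while `w ⊗ w` has rank at most one. Hence `ν = 0`,
and the diagonal entries give `w_i² = 0`. -/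
theorem eq_zero_of_mul_eq_smul_inv (hn : 2 ≤ n) {g : Matrix (Fin n) (Fin n) ℝ} (hg : IsUnit g.det)
    {w : Fin n → ℝ} {ν : ℝ} (h : ∀ i j, w i * w j = ν * g⁻¹ i j) : w = 0 := by
  by_cases hν : ν = 0
  · funext i
    have := h i i
    rw [hν, zero_mul] at this
    exact mul_self_eq_zero.1 this
  · exfalso
    have h1 : Matrix.vecMulVec w w = ν • g⁻¹ := by
      ext i j
      rw [Matrix.vecMulVec_apply, h, Matrix.smul_apply, smul_eq_mul]
    have h2 : (ν • g⁻¹).rank = n := by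
      rw [Matrix.rank_of_isUnit, Fintype.card_fin]
      have hu : IsUnit g⁻¹ :=
        (Matrix.isUnit_iff_isUnit_det _).2 ((Matrix.isUnit_nonsing_inv_det_iff).2 hg)
      exact (hu.smul (Units.mk0 ν hν))
    have h3 := Matrix.rank_vecMulVec_le w w
    rw [h1, h2] at h3
    omega

/-- The infinitesimal change of the independent variables does not depend on `u`. -/
theorem du_field_eq_zero (hn : 2 ≤ n) (hG : IsLocalMetric G U) (hJ : IsOpen J)
    (hF : ContDiffOn ℝ ∞ F (U ×ˢ J)) (hξ : ∀ k, ContDiffOn ℝ ∞ (fun p => ξ p k) (U ×ˢ J))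
    (hη : ContDiffOn ℝ ∞ η (U ×ˢ J)) (h : IsLocalLieSymmetry U J (poissonFunction G F) ξ η)
    (hx : x ∈ U) (hu : u ∈ J) (k : Fin n) : du (fun p => ξ p k) (x, u) = 0 := by
  obtain ⟨μ, hμ⟩ := (isLocalLieSymmetry_iff (by omega) hG hJ hF hξ hη).1 h
  set w : Fin n → ℝ := fun k => du (fun p => ξ p k) (x, u) with hw
  -- Lowering the index of `w` gives a `p` with `g^{ib} p_b = wⁱ`. Subtracting the equations at `p`
  -- and at `0` removes every term without `∂ξ/∂u` and leaves `wⁱ wʲ` proportional to `g^{ij}`.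
  set p : Fin n → ℝ := fun b => ∑ c, G x b c * w c with hp
  have hPp : ∀ i, ∑ b, (G x)⁻¹ i b * p b = w i := by
    intro i
    have h1 : (G x)⁻¹.mulVec ((G x).mulVec w) = w := by
      rw [Matrix.mulVec_mulVec, Matrix.nonsing_inv_mul _ (hG.isUnit_det hx), Matrix.one_mulVec]
    exact congrFun h1 i
  have h0 := fun i j => (hμ x hx u hu 0).1 i j
  have h1 := fun i j => (hμ x hx u hu p).1 i j
  have hdiff : ∀ i j, hessCoeff G ξ η x u p i j - hessCoeff G ξ η x u 0 i j =
      -((G x)⁻¹ i j * ∑ k, p k * w k) - 2 * (w i * w j) := by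
    intro i j
    have e : ∑ b, (G x)⁻¹ i b * (dx b (fun s => ξ s j) (x, u) + p b * w j) =
        ∑ b, (G x)⁻¹ i b * dx b (fun s => ξ s j) (x, u) + w i * w j := by
      rw [← hPp i, Finset.sum_mul, ← Finset.sum_add_distrib]
      exact Finset.sum_congr rfl fun _ _ => by ring
    simp only [hessCoeff]
    rw [e]
    simp
    ring
  have hfin : ∀ i j, w i * w j =
      (-(μ x u p - μ x u 0 + ∑ k, p k * w k) / 2) * (G x)⁻¹ i j := by
    intro i j
    have a1 := h0 i j
    have a2 := h1 i j
    have a3 := hdiff i j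
    have a4 := hdiff j i
    rw [hG.inv_symm hx j i] at a4
    linarith
  exact congrFun (eq_zero_of_mul_eq_smul_inv hn (hG.isUnit_det hx) hfin) k

/-- Evaluation at `0` and at `±p` separates the three degrees. Basis vectors `e_i` then isolate the
`l i` and `h P_{ii}`, and polarisation at `e_i + e_j` isolates `h P_{ij}`. -/
theorem quadratic_eq_zero {c h : ℝ} {l : Fin n → ℝ} {P : Fin n → Fin n → ℝ}
    (hP : ∀ i j, P i j = P j i) (hP0 : ∃ i j, P i j ≠ 0)
    (H : ∀ p : Fin n → ℝ, c + ∑ i, l i * p i + h * ∑ i, ∑ j, P i j * (p i * p j) = 0) :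
    c = 0 ∧ (∀ i, l i = 0) ∧ h = 0 := by
  have hc : c = 0 := by simpa using H 0
  have hneg : ∀ p : Fin n → ℝ, ∑ i, l i * p i = 0 ∧ h * ∑ i, ∑ j, P i j * (p i * p j) = 0 := by
    intro p
    have h1 := H p
    have h2 := H (-p)
    simp only [Pi.neg_apply, mul_neg, neg_mul, neg_neg, Finset.sum_neg_distrib] at h2
    constructor <;> linarith
  refine ⟨hc, fun i => by simpa [Pi.single_apply] using (hneg (Pi.single i 1)).1, ?_⟩
  obtain ⟨i, j, hij⟩ := hP0
  have e1 : ∀ a : Fin n, h * P a a = 0 := fun a => by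
    simpa [Pi.single_apply] using (hneg (Pi.single a 1)).2
  have e2 := (hneg (Pi.single i 1 + Pi.single j 1)).2
  simp only [Pi.add_apply, add_mul, mul_add, Finset.sum_add_distrib, Pi.single_apply] at e2
  simp at e2
  have e3 : h * P i j = 0 := by
    have := hP i j
    have a := e1 i
    have b := e1 j
    rw [← this] at e2
    linarith
  exact (mul_eq_zero.1 e3).resolve_right hij

theorem dx_eq_pd {A : E n × ℝ → ℝ} (hA : DifferentiableAt ℝ A (x, u)) (i : Fin n) :
    dx i A (x, u) = pd i (fun y => A (y, u)) x := by
  have h : HasFDerivAt (fun y : E n => (y, u)) (ContinuousLinearMap.inl ℝ (E n) ℝ) x :=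
    hasFDerivAt_prodMk_left x u
  have h' : HasFDerivAt (fun y => A (y, u))
      ((fderiv ℝ A (x, u)).comp (ContinuousLinearMap.inl ℝ (E n) ℝ)) x :=
    HasFDerivAt.comp x hA.hasFDerivAt h
  rw [pd, h'.fderiv]
  rfl

theorem du_eq_deriv {A : E n × ℝ → ℝ} (hA : DifferentiableAt ℝ A (x, u)) :
    du A (x, u) = deriv (fun s => A (x, s)) u := by
  have h : HasFDerivAt (fun s : ℝ => (x, s)) (ContinuousLinearMap.inr ℝ (E n) ℝ) u :=
    hasFDerivAt_prodMk_right x u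
  have h' : HasFDerivAt (fun s => A (x, s))
      ((fderiv ℝ A (x, u)).comp (ContinuousLinearMap.inr ℝ (E n) ℝ)) u :=
    HasFDerivAt.comp u hA.hasFDerivAt h
  rw [← fderiv_apply_one_eq_deriv, h'.fderiv]
  rfl

theorem contDiffOn_slice {A : E n × ℝ → ℝ} (hA : ContDiffOn ℝ ∞ A (U ×ˢ J)) (hu : u ∈ J) :
    ContDiffOn ℝ ∞ (fun y => A (y, u)) U :=
  hA.comp (contDiff_prodMk_left u).contDiffOn fun _ hy => ⟨hy, hu⟩

theorem dx_dx_eq_pd_pd {A : E n × ℝ → ℝ} (hU : IsOpen U) (hJ : IsOpen J)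
    (hA : ContDiffOn ℝ ∞ A (U ×ˢ J)) (hx : x ∈ U) (hu : u ∈ J) (i j : Fin n) :
    dx j (dx i A) (x, u) = pd j (pd i (fun y => A (y, u))) x := by
  have hS := hU.prod hJ
  rw [dx_eq_pd ((hA.dx hS i).differentiableAt_of_isOpen hS ⟨hx, hu⟩)]
  exact pd_congr hU (fun y hy => dx_eq_pd (hA.differentiableAt_of_isOpen hS ⟨hy, hu⟩) i) hx j

theorem du_dx_comm {A : E n × ℝ → ℝ} (hU : IsOpen U) (hJ : IsOpen J)
    (hA : ContDiffOn ℝ ∞ A (U ×ˢ J)) (hx : x ∈ U) (hu : u ∈ J) (i : Fin n) :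
    du (dx i A) (x, u) = dx i (du A) (x, u) :=
  fderiv_fderiv_comm hA (hU.prod hJ) ⟨hx, hu⟩ _ _

theorem smooth_of_eq_field (hζ : ∀ k, ContDiffOn ℝ ∞ (fun y => ζ y k) U)
    (h : ∀ y ∈ U, ∀ s ∈ J, ξ (y, s) = ζ y) (k : Fin n) :
    ContDiffOn ℝ ∞ (fun p => ξ p k) (U ×ˢ J) := by
  have h1 : ContDiffOn ℝ ∞ (fun p : E n × ℝ => ζ p.1 k) (U ×ˢ J) :=
    (hζ k).comp contDiff_fst.contDiffOn fun _ hp => hp.1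
  exact h1.congr fun p hp => by rw [← h p.1 hp.1 p.2 hp.2]

/-! ### Fields whose components along `M` do not depend on `u` -/

section FieldIndependent

variable (hU : IsOpen U) (hJ : IsOpen J) (hζ : ∀ k, ContDiffOn ℝ ∞ (fun y => ζ y k) U)
  (h : ∀ y ∈ U, ∀ s ∈ J, ξ (y, s) = ζ y)
include hU hJ hζ h

theorem dx_field (hx : x ∈ U) (hu : u ∈ J) (b j : Fin n) :
    dx b (fun s => ξ s j) (x, u) = pd b (fun y => ζ y j) x := by
  rw [dx_eq_pd ((smooth_of_eq_field hζ h j).differentiableAt_of_isOpen (hU.prod hJ) ⟨hx, hu⟩)]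
  exact pd_congr hU (fun y hy => by simp only [h y hy u hu]) hx b

theorem du_field (hx : x ∈ U) (hu : u ∈ J) (j : Fin n) : du (fun s => ξ s j) (x, u) = 0 := by
  rw [du_eq_deriv ((smooth_of_eq_field hζ h j).differentiableAt_of_isOpen (hU.prod hJ) ⟨hx, hu⟩)]
  have : (fun s => ξ (x, s) j) =ᶠ[nhds u] fun _ => ζ x j :=
    Filter.eventuallyEq_of_mem (hJ.mem_nhds hu) fun s hs => by simp only [h x hx s hs]
  rw [this.deriv_eq, deriv_const]

theorem dx_dx_field (hx : x ∈ U) (hu : u ∈ J) (i j k : Fin n) :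
    dx j (dx i (fun s => ξ s k)) (x, u) = pd j (pd i (fun y => ζ y k)) x := by
  rw [dx_dx_eq_pd_pd hU hJ (smooth_of_eq_field hζ h k) hx hu]
  refine pd_congr hU (fun y hy => pd_congr hU (fun z hz => by simp only [h z hz u hu]) hy i) hx j

theorem fderiv_du_field (hx : x ∈ U) (hu : u ∈ J) (k : Fin n) (v : E n × ℝ) :
    fderiv ℝ (du (fun s => ξ s k)) (x, u) v = 0 := by
  rw [fderiv_congr_of_isOpen (g := fun _ => 0) (hU.prod hJ)
    (fun p hp => du_field hU hJ hζ h hp.1 hp.2 k) ⟨hx, hu⟩]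
  simp

theorem hessCoeff_field (hx : x ∈ U) (hu : u ∈ J) (p : Fin n → ℝ) (i j : Fin n) :
    hessCoeff G ξ η x u p i j = fderiv ℝ (fun y => (G y)⁻¹ i j) x (ζ x)
      + (G x)⁻¹ i j * du η (x, u) - 2 * ∑ b, (G x)⁻¹ i b * pd b (fun y => ζ y j) x := by
  simp only [hessCoeff, du_field hU hJ hζ h hx hu, dx_field hU hJ hζ h hx hu, h x hx u hu,
    mul_zero, Finset.sum_const_zero, sub_zero, add_zero]

/-- Without `∂ξ/∂u` the cubic terms in `p` disappear. The quadratic polynomial that remains is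
sorted by degree, ready for `quadratic_eq_zero`. -/
theorem hessFreePart_field (hG : IsLocalMetric G U) (hη : ContDiffOn ℝ ∞ η (U ×ˢ J))
    (hx : x ∈ U) (hu : u ∈ J) (p : Fin n → ℝ) :
    hessFreePart G F ξ η x u p =
      laplacian G (fun y => η (y, u)) x - fderiv ℝ F (x, u) (ζ x, η (x, u))
      + ∑ i, (2 * ∑ j, (G x)⁻¹ i j * dx j (du η) (x, u)
        - ∑ j, ∑ k, (G x)⁻¹ j k * pd k (pd j (fun y => ζ y i)) x
        - ∑ k, ζ x k * pd k (christoffelTrace G i) x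
        + ∑ j, christoffelTrace G j x * pd j (fun y => ζ y i) x
        - christoffelTrace G i x * du η (x, u)) * p i
      + du (du η) (x, u) * ∑ i, ∑ j, (G x)⁻¹ i j * (p i * p j) := by
  have hS := hU.prod hJ
  have z1 : ∀ j k, dx j (du (fun s => ξ s k)) (x, u) = 0 :=
    fun j k => fderiv_du_field hU hJ hζ h hx hu k _
  have z2 : ∀ k, du (du (fun s => ξ s k)) (x, u) = 0 :=
    fun k => fderiv_du_field hU hJ hζ h hx hu k _
  have z3 : ∀ i k, du (dx i (fun s => ξ s k)) (x, u) = 0 :=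
    fun i k => by rw [du_dx_comm hU hJ (smooth_of_eq_field hζ h k) hx hu, z1]
  have z4 := du_field hU hJ hζ h hx hu
  have d1 : ∀ i, dx i η (x, u) = pd i (fun y => η (y, u)) x :=
    fun i => dx_eq_pd (hη.differentiableAt_of_isOpen hS ⟨hx, hu⟩) i
  simp only [hessFreePart, prolong1_eq, z1, z2, z3, z4, dx_field hU hJ hζ h hx hu,
    dx_dx_field hU hJ hζ h hx hu, h x hx u hu, dx_dx_eq_pd_pd hU hJ hη hx hu, d1,
    du_dx_comm hU hJ hη hx hu, mul_zero, add_zero, laplacian, laplaceSymbol,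
    fderiv_apply_eq_sum_pd]
  generalize hDD : (fun i j k => pd j (pd i (fun y => ζ y k)) x) = DD
  have hDD' : ∀ i j k, pd j (pd i (fun y => ζ y k)) x = DD i j k := fun i j k => by rw [← hDD]
  have hs := hG.inv_symm hx
  simp only [hDD']
  generalize du (du η) (x, u) = c
  generalize du η (x, u) = d
  generalize fderiv ℝ F (x, u) (ζ x, η (x, u)) = dF
  have e1 : ∑ i, ∑ j, (G x)⁻¹ i j * (p j * dx i (du η) (x, u)) =
      ∑ i, (∑ j, (G x)⁻¹ i j * dx j (du η) (x, u)) * p i := by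
    rw [Finset.sum_comm]
    refine Finset.sum_congr rfl fun i _ => ?_
    rw [Finset.sum_mul]
    exact Finset.sum_congr rfl fun j _ => by rw [hs i j]; ring
  have e2 : ∑ i, ∑ j, (G x)⁻¹ i j * (p i * dx j (du η) (x, u)) =
      ∑ i, (∑ j, (G x)⁻¹ i j * dx j (du η) (x, u)) * p i := by
    refine Finset.sum_congr rfl fun i _ => ?_
    rw [Finset.sum_mul]
    exact Finset.sum_congr rfl fun j _ => by ring
  have e3 : ∑ i, ∑ j, (G x)⁻¹ i j * ∑ k, p k * DD i j k =
      ∑ i, (∑ j, ∑ k, (G x)⁻¹ j k * DD j k i) * p i := by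
    simp only [Finset.mul_sum, Finset.sum_mul]
    rw [Finset.sum_congr rfl fun i _ => Finset.sum_comm, Finset.sum_comm]
    exact Finset.sum_congr rfl fun _ _ => Finset.sum_congr rfl fun _ _ =>
      Finset.sum_congr rfl fun _ _ => by ring
  have e4 : ∑ i, christoffelTrace G i x * ∑ k, p k * pd i (fun y => ζ y k) x =
      ∑ i, (∑ j, christoffelTrace G j x * pd j (fun y => ζ y i) x) * p i := by
    simp only [Finset.mul_sum, Finset.sum_mul]
    rw [Finset.sum_comm]
    exact Finset.sum_congr rfl fun _ _ => Finset.sum_congr rfl fun _ _ => by ring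
  have e5 : ∑ i, ∑ j, (G x)⁻¹ i j * (p i * (p j * c)) =
      c * ∑ i, ∑ j, (G x)⁻¹ i j * (p i * p j) := by
    simp only [Finset.mul_sum]
    exact Finset.sum_congr rfl fun _ _ => Finset.sum_congr rfl fun _ _ => by ring
  have e6 : ∑ i, christoffelTrace G i x * (p i * d) = ∑ i, christoffelTrace G i x * d * p i :=
    Finset.sum_congr rfl fun _ _ => by ring
  have e7 : ∑ i, 2 * (∑ j, (G x)⁻¹ i j * dx j (du η) (x, u)) * p i =
      2 * ∑ i, (∑ j, (G x)⁻¹ i j * dx j (du η) (x, u)) * p i := by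
    rw [Finset.mul_sum]
    exact Finset.sum_congr rfl fun _ _ => by ring
  simp only [mul_add, mul_sub, add_mul, sub_mul, Finset.sum_add_distrib, Finset.sum_sub_distrib,
    e1, e2, e3, e4, e5, e6, e7]
  ring

/-- The determining equations for a field that does not depend on `u`. -/
theorem isLocalLieSymmetry_field_iff (hn : 0 < n) (hG : IsLocalMetric G U)
    (hF : ContDiffOn ℝ ∞ F (U ×ˢ J)) (hη : ContDiffOn ℝ ∞ η (U ×ˢ J)) :
    IsLocalLieSymmetry U J (poissonFunction G F) ξ η ↔ ∀ x ∈ U, ∀ u ∈ J, ∃ μ : ℝ,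
      lieDerivMetric G ζ x = (du η (x, u) - μ) • G x ∧ du (du η) (x, u) = 0 ∧
      (∀ i, 2 * ∑ j, (G x)⁻¹ i j * dx j (du η) (x, u) =
        ∑ k, ζ x k * pd k (christoffelTrace G i) x
        + ∑ j, ∑ k, (G x)⁻¹ j k * pd k (pd j (fun y => ζ y i)) x
        - ∑ j, christoffelTrace G j x * pd j (fun y => ζ y i) x
        + (du η (x, u) - μ) * christoffelTrace G i x) ∧
      laplacian G (fun y => η (y, u)) x - fderiv ℝ F (x, u) (ζ x, η (x, u)) = -μ * F (x, u) := by
  rw [isLocalLieSymmetry_iff hn hG hJ hF (smooth_of_eq_field hζ h) hη]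
  -- The symmetrised coefficients of `u_{ij}` no longer contain `p`; their equation is the
  -- contravariant form of `L_ζ g = (η_u - μ) g`.
  have conf : ∀ x ∈ U, ∀ u ∈ J, ∀ μ : ℝ, ∀ p, lieDerivMetric G ζ x = (du η (x, u) - μ) • G x ↔
      ∀ i j, hessCoeff G ξ η x u p i j + hessCoeff G ξ η x u p j i = 2 * μ * (G x)⁻¹ i j := by
    intro x hx u hu μ p
    rw [hG.lieDerivMetric_eq_smul_iff hx, ← Matrix.ext_iff]
    refine forall_congr' fun i => forall_congr' fun j => ?_
    rw [hessCoeff_field hU hJ hζ h hx hu, hessCoeff_field hU hJ hζ h hx hu, Matrix.sub_apply,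
      Matrix.add_apply, Matrix.mul_apply, Matrix.mul_apply]
    have e1 : fderiv ℝ (fun y => (G y)⁻¹ j i) x (ζ x) = fderiv ℝ (fun y => (G y)⁻¹ i j) x (ζ x) := by
      rw [fderiv_congr_of_isOpen hU (fun y hy => hG.inv_symm hy j i) hx]
    have e2 : ∑ b, jac ζ x i b * (G x)⁻¹ b j = ∑ b, (G x)⁻¹ j b * pd b (fun y => ζ y i) x :=
      Finset.sum_congr rfl fun b _ => by rw [hG.inv_symm hx b j, mul_comm]; rfl
    rw [e1, e2, hG.inv_symm hx j i]
    simp only [dmat, jac, Matrix.of_apply, Matrix.transpose_apply, Matrix.smul_apply, smul_eq_mul]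
    constructor <;> intro H <;> linarith
  constructor
  · rintro ⟨μ, hμ⟩ x hx u hu
    have hne := hG.exists_inv_ne_zero hx hn
    -- The left side of the first equation is free of `p` and some `g^{ij}` is nonzero, so `μ` is
    -- free of `p` as well. Only then is the second equation a polynomial in `p`.
    have hconst : ∀ p, μ x u p = μ x u 0 := by
      intro p
      obtain ⟨i, j, hij⟩ := hne
      have h1 := (hμ x hx u hu p).1 i j
      have h2 := (hμ x hx u hu 0).1 i j
      rw [hessCoeff_field hU hJ hζ h hx hu, hessCoeff_field hU hJ hζ h hx hu] at h1 h2
      have h3 := h1.symm.trans h2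
      have := mul_right_cancel₀ hij h3
      linarith
    refine ⟨μ x u 0, (conf x hx u hu _ 0).2 (hμ x hx u hu 0).1, ?_⟩
    obtain ⟨a1, a2, a3⟩ := quadratic_eq_zero
      (c := laplacian G (fun y => η (y, u)) x - fderiv ℝ F (x, u) (ζ x, η (x, u))
        + μ x u 0 * F (x, u)) (h := du (du η) (x, u))
      (l := fun i => 2 * ∑ j, (G x)⁻¹ i j * dx j (du η) (x, u)
        - ∑ j, ∑ k, (G x)⁻¹ j k * pd k (pd j (fun y => ζ y i)) x
        - ∑ k, ζ x k * pd k (christoffelTrace G i) x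
        + ∑ j, christoffelTrace G j x * pd j (fun y => ζ y i) x
        - christoffelTrace G i x * du η (x, u) + μ x u 0 * christoffelTrace G i x)
      (P := fun i j => (G x)⁻¹ i j) (hG.inv_symm hx) hne (by
        intro p
        have h1 := (hμ x hx u hu p).2
        rw [hessFreePart_field hU hJ hζ h hG hη hx hu, hconst p] at h1
        simp only [add_mul (_ - _) _ (p _), Finset.sum_add_distrib] at h1 ⊢
        simp only [mul_assoc (μ x u 0), ← Finset.mul_sum] at h1 ⊢
        linarith)
    refine ⟨a3, fun i => ?_, ?_⟩
    · have := a2 i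
      simp only at this
      linarith
    · linarith
  · intro H
    choose! μ hμ using H
    refine ⟨fun x u _ => μ x u, fun x hx u hu p => ?_⟩
    obtain ⟨a1, a2, a3, a4⟩ := hμ x hx u hu
    refine ⟨(conf x hx u hu _ p).1 a1, ?_⟩
    rw [hessFreePart_field hU hJ hζ h hG hη hx hu, a4, a2, zero_mul, add_zero,
      mul_add, add_comm, Finset.mul_sum]
    congr 1
    refine Finset.sum_congr rfl fun i _ => ?_
    rw [a3 i]
    ring

end FieldIndependent

end Splitting

/-! ### The local classification -/

section LocalClassification

variable {n : ℕ} {G : E n → Matrix (Fin n) (Fin n) ℝ} {U : Set (E n)} {J : Set ℝ}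
  {F : E n × ℝ → ℝ} {ξ : E n × ℝ → E n} {η : E n × ℝ → ℝ} {ζ : E n → E n} {ψ : E n → ℝ}
  {x : E n} {u : ℝ}

theorem IsLocalMetric.smul_right_cancel (hG : IsLocalMetric G U) (hx : x ∈ U) (hn : 0 < n)
    {a b : ℝ} (h : a • G x = b • G x) : a = b := by
  have h1 := congrArg (fun A => (A * (G x)⁻¹) ⟨0, hn⟩ ⟨0, hn⟩) h
  simpa [Matrix.mul_nonsing_inv _ (hG.isUnit_det hx)] using h1

/-- The only possible conformal factor of a vector field, `(1 / 2n) g^{ij} (L_ζ g)_{ij}`. -/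
noncomputable def conformalFactor (G : E n → Matrix (Fin n) (Fin n) ℝ) (ζ : E n → E n)
    (x : E n) : ℝ :=
  1 / (2 * n) * ∑ i, ∑ j, (G x)⁻¹ i j * lieDerivMetric G ζ x j i

theorem IsLocalMetric.eq_conformalFactor (hG : IsLocalMetric G U) (hx : x ∈ U) (hn : 0 < n) {c : ℝ}
    (h : lieDerivMetric G ζ x = c • G x) : c = 2 * conformalFactor G ζ x := by
  have h1 : ∑ i, ∑ j, (G x)⁻¹ i j * lieDerivMetric G ζ x j i =
      ((G x)⁻¹ * lieDerivMetric G ζ x).trace := by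
    simp only [Matrix.trace, Matrix.diag, Matrix.mul_apply]
  rw [conformalFactor, h1, h, Matrix.mul_smul, Matrix.nonsing_inv_mul _ (hG.isUnit_det hx),
    Matrix.trace_smul, Matrix.trace_one, Fintype.card_fin, smul_eq_mul]
  have : (n : ℝ) ≠ 0 := by exact_mod_cast hn.ne'
  field_simp

/-- The trace formula is polynomial in `g⁻¹`, `g`, `ζ` and first derivatives, so it is smooth even
before `ζ` is known to be conformal. -/
theorem IsLocalMetric.smooth_conformalFactor (hG : IsLocalMetric G U)
    (hζ : ∀ k, ContDiffOn ℝ ∞ (fun y => ζ y k) U) : ContDiffOn ℝ ∞ (conformalFactor G ζ) U := by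
  unfold conformalFactor lieDerivMetric
  have ho := hG.isOpen
  exact contDiffOn_const.mul (ContDiffOn.sum fun i _ => ContDiffOn.sum fun j _ =>
    (hG.smooth_inv i j).mul (ContDiffOn.sum fun k _ =>
      (((hζ k).mul ((hG.smooth j i).pd ho k)).add ((hG.smooth k i).mul ((hζ k).pd ho j))).add
        ((hG.smooth j k).mul ((hζ k).pd ho i))))

/-- A known conformal factor forces `μ = η_u - 2ψ`, which eliminates the existential. The identity
for the Lie derivative of `Γⁱ` then reduces the linear equation to one between gradients. -/
theorem isLocalLieSymmetry_conformal_iff (hn : 0 < n) (hG : IsLocalMetric G U) (hJ : IsOpen J)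
    (hF : ContDiffOn ℝ ∞ F (U ×ˢ J)) (hη : ContDiffOn ℝ ∞ η (U ×ˢ J))
    (hc : IsLocalConformal G U ζ ψ) (h : ∀ y ∈ U, ∀ s ∈ J, ξ (y, s) = ζ y) :
    IsLocalLieSymmetry U J (poissonFunction G F) ξ η ↔ ∀ x ∈ U, ∀ u ∈ J,
      du (du η) (x, u) = 0 ∧ (∀ j, 2 * dx j (du η) (x, u) = (2 - n) * pd j ψ x) ∧
      laplacian G (fun y => η (y, u)) x - fderiv ℝ F (x, u) (ζ x, η (x, u))
        + (du η (x, u) - 2 * ψ x) * F (x, u) = 0 := by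
  rw [isLocalLieSymmetry_field_iff hG.isOpen hJ hc.smooth_field h hn hG hF hη]
  refine forall_congr' fun x => forall_congr' fun hx => forall_congr' fun u =>
    forall_congr' fun hu => ?_
  have key := hc.lieDeriv_christoffelTrace hG hx
  -- The factor `g^{ij}` is cancelled by invertibility of the metric.
  have inj : (∀ i, 2 * ∑ j, (G x)⁻¹ i j * dx j (du η) (x, u) =
      (2 - n) * ∑ j, (G x)⁻¹ i j * pd j ψ x) ↔
      ∀ j, 2 * dx j (du η) (x, u) = (2 - n) * pd j ψ x := by
    constructor
    · intro H
      have h1 : (G x)⁻¹.mulVec (fun j => 2 * dx j (du η) (x, u)) =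
          (G x)⁻¹.mulVec (fun j => (2 - n) * pd j ψ x) := by
        funext i
        simp only [Matrix.mulVec, dotProduct]
        have := H i
        simp only [Finset.mul_sum] at this
        convert this using 2 <;> ring
      have h2 := congrArg (G x).mulVec h1
      rw [Matrix.mulVec_mulVec, Matrix.mulVec_mulVec, Matrix.mul_nonsing_inv _ (hG.isUnit_det hx),
        Matrix.one_mulVec, Matrix.one_mulVec] at h2
      exact congrFun h2
    · intro H i
      simp only [Finset.mul_sum]
      refine Finset.sum_congr rfl fun j _ => ?_
      linear_combination (G x)⁻¹ i j * H j
  constructor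
  · rintro ⟨μ, h1, h2, h3, h4⟩
    have hμ : du η (x, u) - μ = 2 * ψ x :=
      hG.smul_right_cancel hx hn (h1.symm.trans (hc.lieDeriv_eq hx))
    refine ⟨h2, inj.1 fun i => ?_, ?_⟩
    · rw [h3, hμ, key]
    · rw [h4, ← hμ]
      ring
  · rintro ⟨h2, h3, h4⟩
    refine ⟨du η (x, u) - 2 * ψ x, ?_, h2, fun i => ?_, by linarith⟩
    · rw [hc.lieDeriv_eq hx]
      congr 1
      ring
    · rw [inj.2 h3 i, ← key]
      ring

/-- One value of `u` is enough: it makes `L_ζ g` a multiple of `g`, and the trace identifies the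
multiplier as twice `conformalFactor`. -/
theorem IsLocalConformal.of_isLocalLieSymmetry (hn : 0 < n) (hG : IsLocalMetric G U)
    (hJ : IsOpen J) (hJne : J.Nonempty) (hF : ContDiffOn ℝ ∞ F (U ×ˢ J))
    (hη : ContDiffOn ℝ ∞ η (U ×ˢ J)) (hζ : ∀ k, ContDiffOn ℝ ∞ (fun y => ζ y k) U)
    (h : ∀ y ∈ U, ∀ s ∈ J, ξ (y, s) = ζ y)
    (hs : IsLocalLieSymmetry U J (poissonFunction G F) ξ η) :
    IsLocalConformal G U ζ (conformalFactor G ζ) := by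
  refine ⟨hζ, hG.smooth_conformalFactor hζ, fun {y} hy => ?_⟩
  obtain ⟨u, hu⟩ := hJne
  obtain ⟨μ, h1, -⟩ :=
    (isLocalLieSymmetry_field_iff hG.isOpen hJ hζ h hn hG hF hη).1 hs y hy u hu
  rw [← hG.eq_conformalFactor hy hn h1, h1]

/-- For frozen `u`, the function `η(·, u)` has this form, with `d = a₀ u` a constant that the
Laplacian kills. -/
theorem laplacian_linear_combination (hU : IsOpen U) {α β : E n → ℝ} (hα : ContDiffOn ℝ ∞ α U)
    (hβ : ContDiffOn ℝ ∞ β U) (hx : x ∈ U) (c d : ℝ) :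
    laplacian G (fun y => c * α y + d + β y) x = c * laplacian G α x + laplacian G β x := by
  have p1 : ∀ i, ∀ y ∈ U, pd i (fun y => c * α y + d + β y) y = c * pd i α y + pd i β y := by
    intro i y hy
    have a := hα.differentiableAt_of_isOpen hU hy
    have b := hβ.differentiableAt_of_isOpen hU hy
    rw [pd, fderiv_add_apply ((a.const_mul c).fun_add (differentiableAt_const d)) b,
      fderiv_add_apply (a.const_mul c) (differentiableAt_const d), fderiv_const_mul_apply a]
    simp [pd]
  have p2 : ∀ i j, pd j (pd i (fun y => c * α y + d + β y)) x =
      c * pd j (pd i α) x + pd j (pd i β) x := by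
    intro i j
    have a := (hα.pd hU i).differentiableAt_of_isOpen hU hx
    have b := (hβ.pd hU i).differentiableAt_of_isOpen hU hx
    rw [pd_congr hU (p1 i) hx, pd, fderiv_add_apply (a.const_mul c) b, fderiv_const_mul_apply a]
    rfl
  simp only [laplacian, laplaceSymbol, p2, p1 _ x hx, mul_add, Finset.sum_add_distrib,
    mul_left_comm _ c, ← Finset.mul_sum]
  ring

/-- The local form of the classification, with the shape of `X` given. -/
theorem isLocalLieSymmetry_affine_iff (hn : 0 < n) (hG : IsLocalMetric G U) (hJ : IsOpen J)
    (hF : ContDiffOn ℝ ∞ F (U ×ˢ J)) (hc : IsLocalConformal G U ζ ψ) {b : E n → ℝ} {a₀ : ℝ}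
    (hb : ContDiffOn ℝ ∞ b U) (h : ∀ y ∈ U, ∀ s ∈ J, ξ (y, s) = ζ y)
    (hηeq : ∀ y ∈ U, ∀ s ∈ J, η (y, s) = (2 - (n : ℝ)) / 2 * ψ y * s + a₀ * s + b y) :
    IsLocalLieSymmetry U J (poissonFunction G F) ξ η ↔ ∀ x ∈ U, ∀ u ∈ J,
      (2 - (n : ℝ)) / 2 * laplacian G ψ x * u + laplacian G b x
        - ∑ k, ζ x k * pd k (fun z => F (z, u)) x
        - ((2 - (n : ℝ)) / 2 * ψ x + a₀) * u * deriv (fun s => F (x, s)) u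
        + (a₀ - ((n : ℝ) + 2) / 2 * ψ x) * F (x, u) - b x * deriv (fun s => F (x, s)) u = 0 := by
  have hU := hG.isOpen
  have hS := hU.prod hJ
  have hψ := hc.smooth_factor
  have s1 : ContDiffOn ℝ ∞ (fun p : E n × ℝ => ψ p.1) (U ×ˢ J) :=
    hψ.comp contDiff_fst.contDiffOn fun _ hp => hp.1
  have s2 : ContDiffOn ℝ ∞ (fun p : E n × ℝ => b p.1) (U ×ˢ J) :=
    hb.comp contDiff_fst.contDiffOn fun _ hp => hp.1
  have hη : ContDiffOn ℝ ∞ η (U ×ˢ J) := by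
    have : ContDiffOn ℝ ∞ (fun p : E n × ℝ => (2 - (n : ℝ)) / 2 * ψ p.1 * p.2 + a₀ * p.2 + b p.1)
        (U ×ˢ J) :=
      (((contDiffOn_const.mul s1).mul contDiff_snd.contDiffOn).add
        (contDiffOn_const.mul contDiff_snd.contDiffOn)).add s2
    exact this.congr fun p hp => hηeq p.1 hp.1 p.2 hp.2
  -- An identity on the whole open product, so that it can be differentiated once more in `d2`.
  have d1 : EqOn (du η) (fun p => (2 - (n : ℝ)) / 2 * ψ p.1 + a₀) (U ×ˢ J) := by
    rintro ⟨y, s⟩ ⟨hy, hs⟩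
    rw [du_eq_deriv (hη.differentiableAt_of_isOpen hS ⟨hy, hs⟩)]
    have e : (fun s => η (y, s)) =ᶠ[nhds s]
        fun s => ((2 - (n : ℝ)) / 2 * ψ y + a₀) * s + b y :=
      Filter.eventuallyEq_of_mem (hJ.mem_nhds hs) fun t ht => by
        simp only [hηeq y hy t ht]; ring
    rw [e.deriv_eq]
    simp
  rw [isLocalLieSymmetry_conformal_iff hn hG hJ hF hη hc h]
  refine forall_congr' fun x => forall_congr' fun hx => forall_congr' fun u =>
    forall_congr' fun hu => ?_
  have hxu : (x, u) ∈ U ×ˢ J := ⟨hx, hu⟩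
  have d2 : ∀ v, fderiv ℝ (du η) (x, u) v =
      (2 - (n : ℝ)) / 2 * fderiv ℝ ψ x v.1 := by
    intro v
    have hd := fderiv_comp_fst (z := (x, u)) (hψ.differentiableAt_of_isOpen hU hx) v
    rw [fderiv_congr_of_isOpen hS d1 hxu, fderiv_add_apply (hd.1.const_mul _)
      (differentiableAt_const _), fderiv_const_mul_apply hd.1, hd.2]
    simp
  have d3 : du (du η) (x, u) = 0 := by rw [du, d2]; simp
  have d4 : ∀ j, 2 * dx j (du η) (x, u) = (2 - n) * pd j ψ x := by
    intro j
    rw [dx, d2, pd]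
    ring
  have d5 : laplacian G (fun y => η (y, u)) x =
      (2 - (n : ℝ)) / 2 * u * laplacian G ψ x + laplacian G b x := by
    rw [← laplacian_linear_combination hU hψ hb hx ((2 - (n : ℝ)) / 2 * u) (a₀ * u)]
    have e : EqOn (fun y => η (y, u)) (fun y => (2 - (n : ℝ)) / 2 * u * ψ y + a₀ * u + b y) U :=
      fun y hy => by simp only [hηeq y hy u hu]; ring
    have e1 : ∀ i, ∀ y ∈ U, pd i (fun y => η (y, u)) y =
        pd i (fun y => (2 - (n : ℝ)) / 2 * u * ψ y + a₀ * u + b y) y :=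
      fun i y hy => pd_congr hU e hy i
    simp only [laplacian, e1 _ x hx, fun i j => pd_congr hU (e1 i) hx j]
  have hFd := hF.differentiableAt_of_isOpen hS hxu
  rw [d5, d1 hxu, fderiv_prod_apply', hηeq x hx u hu, du_eq_deriv hFd]
  simp only [dx_eq_pd hFd, d3, d4, implies_true, true_and]
  -- The coefficient of `f` is `η_u - 2ψ = (2 - n)/2 ψ + a₀ - 2ψ = a₀ - (n + 2)/2 ψ`.
  refine Eq.congr_left ?_
  ring

end LocalClassification

/-! ### Naturality of the Lie derivative under a change of coordinates -/

section Naturality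

variable {n : ℕ} {U U' : Set (E n)} {x : E n}

theorem dmat_mul {A B : E n → Matrix (Fin n) (Fin n) ℝ} (hU : IsOpen U) (hx : x ∈ U)
    (hA : ∀ i j, ContDiffOn ℝ ∞ (fun y => A y i j) U)
    (hB : ∀ i j, ContDiffOn ℝ ∞ (fun y => B y i j) U) (v : E n) :
    dmat (fun y => A y * B y) x v = dmat A x v * B x + A x * dmat B x v := by
  ext i j
  have a := fun i j => (hA i j).differentiableAt_of_isOpen hU hx
  have b := fun i j => (hB i j).differentiableAt_of_isOpen hU hx
  simp only [dmat, Matrix.of_apply, Matrix.add_apply, Matrix.mul_apply]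
  rw [fderiv_sum_apply fun k => (a i k).fun_mul (b k j), ← Finset.sum_add_distrib]
  exact Finset.sum_congr rfl fun k _ => fderiv_mul_apply (a i k) (b k j) v

theorem dmat_congr {A B : E n → Matrix (Fin n) (Fin n) ℝ} (hU : IsOpen U) (hx : x ∈ U)
    (h : EqOn A B U) (v : E n) : dmat A x v = dmat B x v := by
  ext i j
  simp only [dmat, Matrix.of_apply]
  rw [fderiv_congr_of_isOpen hU (fun y hy => by rw [h hy]) hx]

theorem contDiffOn_matrix_mul {A B : E n → Matrix (Fin n) (Fin n) ℝ}
    (hA : ∀ i j, ContDiffOn ℝ ∞ (fun y => A y i j) U)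
    (hB : ∀ i j, ContDiffOn ℝ ∞ (fun y => B y i j) U) (i j : Fin n) :
    ContDiffOn ℝ ∞ (fun y => (A y * B y) i j) U := by
  simp only [Matrix.mul_apply]
  exact ContDiffOn.sum fun k _ => (hA i k).mul (hB k j)

theorem fderiv_coord_apply {τ : E n → E n} (hτ : DifferentiableAt ℝ τ x) (k : Fin n) (v : E n) :
    fderiv ℝ (fun y => τ y k) x v = fderiv ℝ τ x v k := by
  have h : HasFDerivAt (fun y => τ y k)
      (ContinuousLinearMap.comp (EuclideanSpace.proj k : E n →L[ℝ] ℝ) (fderiv ℝ τ x)) x :=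
    HasFDerivAt.comp x (EuclideanSpace.proj k : E n →L[ℝ] ℝ).hasFDerivAt
      hτ.hasFDerivAt
  rw [h.fderiv]
  rfl

theorem fderiv_apply_eq_jac_mulVec {τ : E n → E n} (hτ : DifferentiableAt ℝ τ x) (v : E n)
    (k : Fin n) : fderiv ℝ τ x v k = ∑ m, jac τ x k m * v m := by
  rw [← fderiv_coord_apply hτ, fderiv_apply_eq_sum_pd]
  exact Finset.sum_congr rfl fun m _ => mul_comm _ _

theorem fderiv_comp_apply {f : E n → ℝ} {τ : E n → E n} (hf : DifferentiableAt ℝ f (τ x))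
    (hτ : DifferentiableAt ℝ τ x) (v : E n) :
    fderiv ℝ (fun y => f (τ y)) x v = fderiv ℝ f (τ x) (fderiv ℝ τ x v) := by
  have h : HasFDerivAt (fun y => f (τ y)) ((fderiv ℝ f (τ x)).comp (fderiv ℝ τ x)) x :=
    HasFDerivAt.comp x hf.hasFDerivAt hτ.hasFDerivAt
  rw [h.fderiv]
  rfl

/-- With `T` the Jacobian of `τ`, differentiating `G = Tᵗ (G' ∘ τ) T` along `ζ` produces derivatives
of `T`, which are governed by the relation between `ζ` and `ζ'`. What remains is an identity in the
noncommutative ring of matrices. -/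
theorem lieDerivMetric_naturality {G G' : E n → Matrix (Fin n) (Fin n) ℝ} {ζ ζ' τ : E n → E n}
    (hU : IsOpen U) (hU' : IsOpen U') (hτ : ContDiffOn ℝ ∞ τ U) (hmaps : MapsTo τ U U')
    (hG' : ∀ i j, ContDiffOn ℝ ∞ (fun y => G' y i j) U')
    (hζ : ∀ k, ContDiffOn ℝ ∞ (fun y => ζ y k) U)
    (hζ' : ∀ k, ContDiffOn ℝ ∞ (fun y => ζ' y k) U')
    (hGG' : ∀ y ∈ U, G y = (jac τ y).transpose * G' (τ y) * jac τ y)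
    (hζζ' : ∀ y ∈ U, ζ' (τ y) = fderiv ℝ τ y (ζ y)) (hx : x ∈ U) :
    lieDerivMetric G ζ x =
      (jac τ x).transpose * lieDerivMetric G' ζ' (τ x) * jac τ x := by
  have hτd : ∀ y ∈ U, DifferentiableAt ℝ τ y := fun y hy =>
    (hτ.contDiffAt (hU.mem_nhds hy)).differentiableAt (by simp)
  have hτk : ∀ k, ContDiffOn ℝ ∞ (fun y => τ y k) U := contDiffOn_euclidean.1 hτ
  have hT : ∀ i j, ContDiffOn ℝ ∞ (fun y => jac τ y i j) U := fun i j => (hτk i).pd hU j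
  have hTt : ∀ i j, ContDiffOn ℝ ∞ (fun y => (jac τ y).transpose i j) U := fun i j => hT j i
  have hG'τ : ∀ i j, ContDiffOn ℝ ∞ (fun y => G' (τ y) i j) U :=
    fun i j => (hG' i j).comp hτ hmaps
  -- Differentiating `ζ' ∘ τ = T ζ` gives `Dζ' T = (∂T) ζ + T Dζ`. Symmetry of the second
  -- derivatives of `τ` turns `(∂T) ζ` into the derivative of `T` along `ζ`.
  have hdT : dmat (jac τ) x (ζ x) = jac ζ' (τ x) * jac τ x - jac τ x * jac ζ x := by
    ext k i
    have heq : EqOn (fun y => ζ' (τ y) k) (fun y => ∑ m, jac τ y k m * ζ y m) U := fun y hy => by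
      simp only [hζζ' y hy, fderiv_apply_eq_jac_mulVec (hτd y hy)]
    have h1 := pd_congr hU heq hx i
    have a := fun m => (hT k m).differentiableAt_of_isOpen hU hx
    have b := fun m => (hζ m).differentiableAt_of_isOpen hU hx
    rw [pd, fderiv_comp_apply ((hζ' k).differentiableAt_of_isOpen hU' (hmaps hx)) (hτd x hx), pd,
      fderiv_sum_apply fun m => (a m).fun_mul (b m)] at h1
    simp only [fderiv_mul_apply (a _) (b _), Finset.sum_add_distrib, fderiv_apply_eq_sum_pd,
      ← fderiv_coord_apply (hτd x hx)] at h1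
    simp only [← fderiv_apply_eq_sum_pd] at h1
    have h2 : ∀ m, fderiv ℝ (fun y => jac τ y k m) x (e i) =
        pd m (fun y => jac τ y k i) x := fun m => pd_comm (hτk k) hU hx i m
    simp only [h2] at h1
    simp only [Matrix.sub_apply, Matrix.mul_apply, dmat, Matrix.of_apply, fderiv_apply_eq_sum_pd]
    have h3 : ∑ j, jac ζ' (τ x) k j * jac τ x j i =
        ∑ j, fderiv ℝ (fun y => τ y j) x (e i) * pd j (fun y => ζ' y k) (τ x) :=
      Finset.sum_congr rfl fun j _ => mul_comm _ _
    have h4 : ∑ j, jac τ x k j * jac ζ x j i =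
        ∑ j, jac τ x k j * fderiv ℝ (fun y => ζ y j) x (e i) := rfl
    have h5 : ∑ m, ζ x m * pd m (fun y => jac τ y k i) x =
        ∑ m, pd m (fun y => jac τ y k i) x * ζ x m :=
      Finset.sum_congr rfl fun j _ => mul_comm _ _
    rw [h3, h4, h5, h1]
    ring
  have hdTt : dmat (fun y => (jac τ y).transpose) x (ζ x) =
      (jac ζ' (τ x) * jac τ x - jac τ x * jac ζ x).transpose := by
    rw [← hdT]
    rfl
  have hdG' : dmat (fun y => G' (τ y)) x (ζ x) = dmat G' (τ x) (ζ' (τ x)) := by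
    ext i j
    simp only [dmat, Matrix.of_apply]
    rw [fderiv_comp_apply ((hG' i j).differentiableAt_of_isOpen hU' (hmaps hx)) (hτd x hx),
      hζζ' x hx]
  rw [lieDerivMetric_eq, lieDerivMetric_eq, dmat_congr hU hx hGG',
    dmat_mul hU hx (contDiffOn_matrix_mul hTt hG'τ) hT, dmat_mul hU hx hTt hG'τ, hdT, hdTt, hdG',
    hGG' x hx]
  simp only [Matrix.transpose_sub, Matrix.transpose_mul]
  noncomm_ring

end Naturality

/-! ### Charts -/

section Charts

variable {n : ℕ} {M : Type*} [TopologicalSpace M] [ChartedSpace (E n) M]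
  {φ : OpenPartialHomeomorph M (E n)} {y : E n}

theorem IsChart.contMDiffOn (hφ : IsChart φ) : ContMDiffOn (𝓡 n) (𝓡 n) ∞ φ φ.source :=
  contMDiffOn_of_mem_maximalAtlas hφ

theorem IsChart.contMDiffOn_symm (hφ : IsChart φ) :
    ContMDiffOn (𝓡 n) (𝓡 n) ∞ φ.symm φ.target :=
  contMDiffOn_symm_of_mem_maximalAtlas hφ

theorem IsChart.mdifferentiable (hφ : IsChart φ) : φ.MDifferentiable (𝓡 n) (𝓡 n) :=
  ⟨hφ.contMDiffOn.mdifferentiableOn (by simp), hφ.contMDiffOn_symm.mdifferentiableOn (by simp)⟩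

theorem IsChart.mfderiv_comp_symm (hφ : IsChart φ) (hy : y ∈ φ.target) (v : E n) :
    mfderiv (𝓡 n) (𝓡 n) φ (φ.symm y) (mfderiv (𝓡 n) (𝓡 n) φ.symm y v) = v :=
  DFunLike.congr_fun (hφ.mdifferentiable.comp_symm_deriv hy) v

theorem IsChart.mfderiv_symm_comp (hφ : IsChart φ) (hy : y ∈ φ.target)
    (v : TangentSpace (𝓡 n) (φ.symm y)) :
    mfderiv (𝓡 n) (𝓡 n) φ.symm y (mfderiv (𝓡 n) (𝓡 n) φ (φ.symm y) v) = v := by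
  have h := DFunLike.congr_fun (hφ.mdifferentiable.symm_comp_deriv (φ.map_target hy)) v
  have e := φ.right_inv hy
  rw [ContinuousLinearMap.comp_apply] at h
  rw [e] at h
  exact h

theorem IsChart.contDiffOn_comp_symm (hφ : IsChart φ) {b : M → ℝ}
    (hb : ContMDiff (𝓡 n) 𝓘(ℝ, ℝ) ∞ b) : ContDiffOn ℝ ∞ (b ∘ φ.symm) φ.target :=
  (hb.comp_contMDiffOn hφ.contMDiffOn_symm).contDiffOn

theorem IsChart.contMDiffOn_prod_symm (hφ : IsChart φ) (J : Set ℝ) :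
    ContMDiffOn 𝓘(ℝ, E n × ℝ) ((𝓡 n).prod 𝓘(ℝ, ℝ)) ∞
      (fun p : E n × ℝ => (φ.symm p.1, p.2)) (φ.target ×ˢ J) :=
  (hφ.contMDiffOn_symm.comp contDiff_fst.contMDiff.contMDiffOn fun _ hp => hp.1).prodMk
    contDiff_snd.contMDiff.contMDiffOn

theorem IsChart.contDiffOn_coordFun (hφ : IsChart φ) {J : Set ℝ} {f : M → ℝ → ℝ}
    (hf : IsSmoothFunOn (n := n) J f) : ContDiffOn ℝ ∞ (coordFun φ f) (φ.target ×ˢ J) :=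
  (ContMDiffOn.comp (g := fun p : M × ℝ => f p.1 p.2) hf (hφ.contMDiffOn_prod_symm J)
    fun _ hp => ⟨mem_univ _, hp.2⟩).contDiffOn

variable [IsManifold (𝓡 n) ∞ M]

theorem isChart_chartAt (x : M) : IsChart (chartAt (E n) x) :=
  IsManifold.chart_mem_maximalAtlas x

theorem contMDiff_of_charts {b : M → ℝ}
    (h : ∀ φ : OpenPartialHomeomorph M (E n), IsChart φ → ContDiffOn ℝ ∞ (b ∘ φ.symm) φ.target) :
    ContMDiff (𝓡 n) 𝓘(ℝ, ℝ) ∞ b := by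
  intro x
  set φ := chartAt (E n) x with hφ
  have hc : IsChart φ := isChart_chartAt x
  have h1 : ContMDiffOn (𝓡 n) 𝓘(ℝ, ℝ) ∞ (fun z => (b ∘ φ.symm) (φ z)) φ.source :=
    (h φ hc).contMDiffOn.comp hc.contMDiffOn fun z hz => φ.map_source hz
  have h2 : ContMDiffOn (𝓡 n) 𝓘(ℝ, ℝ) ∞ b φ.source :=
    h1.congr fun z hz => by simp [φ.left_inv hz]
  exact h2.contMDiffAt (φ.open_source.mem_nhds (mem_chart_source (E n) x))

/-- The fibre component of the tangent map of the chart. Smoothness jointly in point and vector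
yields smooth components both for fields on `M` and for fields depending on `u`. -/
theorem IsChart.contMDiffOn_mfderiv_snd (hφ : IsChart φ) :
    ContMDiffOn (𝓡 n).tangent 𝓘(ℝ, E n) ∞
      (fun p : TangentBundle (𝓡 n) M => (mfderiv (𝓡 n) (𝓡 n) φ p.1 p.2 : E n))
      (Bundle.TotalSpace.proj ⁻¹' φ.source) := by
  have h1 := hφ.contMDiffOn.contMDiffOn_tangentMapWithin (m := ∞) (by simp)
    φ.open_source.uniqueMDiffOn
  have h2 := (contMDiff_snd_tangentBundle_modelSpace (n := ∞) (E n) (𝓡 n)).comp_contMDiffOn h1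
  refine h2.congr fun p hp => ?_
  simp only [Function.comp, tangentMapWithin]
  rw [mfderivWithin_of_isOpen φ.open_source hp]

theorem IsChart.contDiffOn_coordField_param (hφ : IsChart φ) {J : Set ℝ}
    {ξ : (x : M) → ℝ → TangentSpace (𝓡 n) x} (hξ : IsSmoothFieldOn J ξ) :
    ContDiffOn ℝ ∞ (fun p : E n × ℝ => coordField φ (fun x => ξ x p.2) p.1) (φ.target ×ˢ J) := by
  have h1 : ContMDiffOn 𝓘(ℝ, E n × ℝ) (𝓡 n).tangent ∞
      (fun p : E n × ℝ => (⟨φ.symm p.1, ξ (φ.symm p.1) p.2⟩ : TangentBundle (𝓡 n) M))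
      (φ.target ×ˢ J) :=
    ContMDiffOn.comp (g := fun p : M × ℝ => (⟨p.1, ξ p.1 p.2⟩ : TangentBundle (𝓡 n) M)) hξ
      (hφ.contMDiffOn_prod_symm J) fun _ hp => ⟨mem_univ _, hp.2⟩
  exact (hφ.contMDiffOn_mfderiv_snd.comp h1 fun p hp => φ.map_target hp.1).contDiffOn

theorem IsChart.contDiffOn_coordField (hφ : IsChart φ) {ζ : (x : M) → TangentSpace (𝓡 n) x}
    (hζ : IsSmoothField ζ) : ContDiffOn ℝ ∞ (coordField φ ζ) φ.target := by
  have h1 : ContMDiffOn 𝓘(ℝ, E n) (𝓡 n).tangent ∞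
      (fun y => (⟨φ.symm y, ζ (φ.symm y)⟩ : TangentBundle (𝓡 n) M)) φ.target :=
    ContMDiff.comp_contMDiffOn (g := fun x => (⟨x, ζ x⟩ : TangentBundle (𝓡 n) M)) hζ
      hφ.contMDiffOn_symm
  exact (hφ.contMDiffOn_mfderiv_snd.comp h1 fun p hp => φ.map_target hp).contDiffOn

/-- The coordinate frame is the tangent map of `φ.symm` composed with a constant section. -/
theorem IsChart.contMDiffOn_frame (hφ : IsChart φ) (i : Fin n) :
    ContMDiffOn 𝓘(ℝ, E n) (𝓡 n).tangent ∞
      (fun y => (⟨φ.symm y, mfderiv (𝓡 n) (𝓡 n) φ.symm y (e i)⟩ : TangentBundle (𝓡 n) M))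
      φ.target := by
  have h1 := hφ.contMDiffOn_symm.contMDiffOn_tangentMapWithin (m := ∞) (by simp)
    φ.open_target.uniqueMDiffOn
  have h2 : ContMDiffOn 𝓘(ℝ, E n) (𝓡 n).tangent ∞
      (fun y => (⟨y, e i⟩ : TangentBundle (𝓡 n) (E n))) φ.target := fun y _ =>
    contMDiffWithinAt_vectorSpace_iff_contDiffWithinAt.2 contDiffWithinAt_const
  refine (h1.comp h2 fun y hy => hy).congr fun y hy => ?_
  simp only [Function.comp, tangentMapWithin]
  rw [mfderivWithin_of_isOpen φ.open_target hy]

/-! ### Components of the metric in a chart -/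

variable (g : Metric n M)

theorem Metric.contDiffOn_coord (hφ : IsChart φ) (i j : Fin n) :
    ContDiffOn ℝ ∞ (fun y => g.coord φ y i j) φ.target := by
  refine ContMDiffOn.contDiffOn fun y hy => ?_
  -- The scalar product of two frame vectors is viewed as a section of the trivial line bundle, so
  -- that evaluation of a smooth bilinear form on smooth sections applies.
  have : ContMDiffWithinAt (𝓡 n) ((𝓡 n).prod 𝓘(ℝ)) ∞
      (fun y => Bundle.TotalSpace.mk' ℝ (E := Bundle.Trivial M ℝ) (φ.symm y)
        (g.inner (φ.symm y) (mfderiv (𝓡 n) (𝓡 n) φ.symm y (e i))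
          (mfderiv (𝓡 n) (𝓡 n) φ.symm y (e j)))) φ.target y := by
    apply ContMDiffWithinAt.clm_bundle_apply₂ (F₁ := E n) (F₂ := E n)
    · exact ContMDiffAt.comp_contMDiffWithinAt y g.contMDiff.contMDiffAt
        (hφ.contMDiffOn_symm y hy)
    · exact hφ.contMDiffOn_frame i y hy
    · exact hφ.contMDiffOn_frame j y hy
  simp only [Bundle.contMDiffWithinAt_totalSpace] at this
  exact this.2

theorem Metric.inner_mfderiv_symm (y v w : E n) :
    g.inner (φ.symm y) (mfderiv (𝓡 n) (𝓡 n) φ.symm y v) (mfderiv (𝓡 n) (𝓡 n) φ.symm y w) =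
      ∑ i, ∑ j, v i * g.coord φ y i j * w j := by
  let L : E n →L[ℝ] E n := mfderiv (𝓡 n) (𝓡 n) φ.symm y
  let B : E n →L[ℝ] E n →L[ℝ] ℝ := g.inner (φ.symm y)
  change B (L v) (L w) = ∑ i, ∑ j, v i * B (L (e i)) (L (e j)) * w j
  conv_lhs => rw [← sum_smul_e v, ← sum_smul_e w]
  simp only [map_sum, map_smul, sum_apply, smul_apply,
    smul_eq_mul, Finset.mul_sum]
  rw [Finset.sum_comm]
  exact Finset.sum_congr rfl fun _ _ => Finset.sum_congr rfl fun _ _ => by ring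

theorem Metric.isLocalMetric (hφ : IsChart φ) : IsLocalMetric (g.coord φ) φ.target where
  isOpen := φ.open_target
  smooth := g.contDiffOn_coord hφ
  symm _ i j := g.symm _ _ _
  isUnit_det {y} hy := by
    rw [isUnit_iff_ne_zero]
    intro h0
    -- A kernel vector of the component matrix represents a tangent vector orthogonal to every `z`,
    -- since every `z` comes from coordinates. Nondegeneracy then makes it zero.
    obtain ⟨v, hv0, hv⟩ := Matrix.exists_mulVec_eq_zero_iff.2 h0
    set w : E n := WithLp.toLp 2 v with hw
    have h1 : mfderiv (𝓡 n) (𝓡 n) φ.symm y w = 0 := by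
      refine g.nondegenerate _ _ fun z => ?_
      rw [g.symm, ← hφ.mfderiv_symm_comp hy z]
      refine (g.inner_mfderiv_symm (φ := φ) y (mfderiv (𝓡 n) (𝓡 n) φ (φ.symm y) z) w).trans ?_
      refine Finset.sum_eq_zero fun i _ => ?_
      have := congrFun hv i
      simp only [Matrix.mulVec, dotProduct, Pi.zero_apply] at this
      simp only [mul_assoc, ← Finset.mul_sum]
      rw [show ∑ j, g.coord φ y i j * w j = 0 from this, mul_zero]
    have h2 := hφ.mfderiv_comp_symm hy w
    rw [h1, map_zero] at h2
    exact hv0 (by rw [show v = w.ofLp from rfl, ← h2]; rfl)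

end Charts

/-! ### The global classification -/

section Global

variable {n : ℕ} {M : Type*} [TopologicalSpace M] [ChartedSpace (E n) M]
  {φ φ' : OpenPartialHomeomorph M (E n)} {J : Set ℝ} {ζ : (x : M) → TangentSpace (𝓡 n) x}

theorem coordField_congr {ζ' : (x : M) → TangentSpace (𝓡 n) x} {y : E n}
    (h : ζ (φ.symm y) = ζ' (φ.symm y)) : coordField φ ζ y = coordField φ ζ' y :=
  congrArg (mfderiv (𝓡 n) (𝓡 n) φ (φ.symm y)) h

theorem IsSmoothFunOn.contMDiff {f : M → ℝ → ℝ} (hf : IsSmoothFunOn (n := n) J f) {u : ℝ}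
    (hu : u ∈ J) : ContMDiff (𝓡 n) 𝓘(ℝ, ℝ) ∞ fun x => f x u := by
  have h : ContMDiff (𝓡 n) ((𝓡 n).prod 𝓘(ℝ, ℝ)) ∞ (fun x : M => (x, u)) :=
    contMDiff_id.prodMk contMDiff_const
  exact contMDiffOn_univ.1 (ContMDiffOn.comp (g := fun p : M × ℝ => f p.1 p.2) hf h.contMDiffOn
    fun _ _ => ⟨mem_univ _, hu⟩)

/-! ### Changes of chart -/

section Transition

variable (hφ : IsChart φ) (hφ' : IsChart φ')
include hφ hφ'

theorem transition_isOpen_maps :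
    IsOpen (φ.target ∩ φ.symm ⁻¹' φ'.source) ∧
      MapsTo (φ' ∘ φ.symm) (φ.target ∩ φ.symm ⁻¹' φ'.source) φ'.target ∧
      ContDiffOn ℝ ∞ (φ' ∘ φ.symm) (φ.target ∩ φ.symm ⁻¹' φ'.source) := by
  refine ⟨φ.isOpen_inter_preimage_symm φ'.open_source, fun y hy => φ'.map_source hy.2, ?_⟩
  exact (hφ'.contMDiffOn.comp (hφ.contMDiffOn_symm.mono inter_subset_left)
    fun y hy => hy.2).contDiffOn

theorem fderiv_transition {y : E n} (hy : y ∈ φ.target ∩ φ.symm ⁻¹' φ'.source) (v : E n) :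
    fderiv ℝ (φ' ∘ φ.symm) y v =
      mfderiv (𝓡 n) (𝓡 n) φ' (φ.symm y) (mfderiv (𝓡 n) (𝓡 n) φ.symm y v) := by
  rw [← mfderiv_eq_fderiv, mfderiv_comp y (hφ'.mdifferentiable.mdifferentiableAt hy.2)
    (hφ.mdifferentiable.mdifferentiableAt_symm hy.1)]
  rfl

theorem coordField_transition (ζ : (x : M) → TangentSpace (𝓡 n) x) {y : E n}
    (hy : y ∈ φ.target ∩ φ.symm ⁻¹' φ'.source) :
    coordField φ' ζ ((φ' ∘ φ.symm) y) = fderiv ℝ (φ' ∘ φ.symm) y (coordField φ ζ y) := by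
  rw [fderiv_transition hφ hφ' hy]
  have h1 : φ'.symm ((φ' ∘ φ.symm) y) = φ.symm y := φ'.left_inv hy.2
  have h2 := hφ.mfderiv_symm_comp hy.1 (ζ (φ.symm y))
  simp only [coordField]
  rw [h1]
  exact congrArg (mfderiv (𝓡 n) (𝓡 n) φ' (φ.symm y)) h2.symm

variable [IsManifold (𝓡 n) ∞ M] {g : Metric n M}

theorem Metric.coord_transition (g : Metric n M) {y : E n}
    (hy : y ∈ φ.target ∩ φ.symm ⁻¹' φ'.source) :
    g.coord φ y = (jac (φ' ∘ φ.symm) y).transpose * g.coord φ' ((φ' ∘ φ.symm) y)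
      * jac (φ' ∘ φ.symm) y := by
  obtain ⟨ho, hm, hs⟩ := transition_isOpen_maps hφ hφ'
  have hd : DifferentiableAt ℝ (φ' ∘ φ.symm) y :=
    (hs.contDiffAt (ho.mem_nhds hy)).differentiableAt (by simp)
  set z := (φ' ∘ φ.symm) y with hz
  have h1 : φ'.symm z = φ.symm y := φ'.left_inv hy.2
  have h2 : ∀ v : E n, mfderiv (𝓡 n) (𝓡 n) φ'.symm z (fderiv ℝ (φ' ∘ φ.symm) y v) =
      mfderiv (𝓡 n) (𝓡 n) φ.symm y v := by
    intro v
    rw [fderiv_transition hφ hφ' hy]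
    have := hφ'.mfderiv_symm_comp (hm hy)
    rw [← hz, h1] at this
    exact this _
  have h3 : ∀ i k, fderiv ℝ (φ' ∘ φ.symm) y (e i) k = jac (φ' ∘ φ.symm) y k i := fun i k =>
    (fderiv_coord_apply hd k (e i)).symm
  ext i j
  have h4 := g.inner_mfderiv_symm (φ := φ') z (fderiv ℝ (φ' ∘ φ.symm) y (e i))
    (fderiv ℝ (φ' ∘ φ.symm) y (e j))
  rw [h2, h2, h1] at h4
  refine h4.trans ?_
  simp only [h3, Matrix.mul_apply, Matrix.transpose_apply, Finset.sum_mul]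
  exact Finset.sum_comm

/-- By naturality the equation `L_ζ g = c g` passes to the other chart with the same `c`, and in
each chart the trace recovers `c`. -/
theorem conformalFactor_transition (hn : 0 < n) (hζ : IsSmoothField ζ) {y : E n} {c : ℝ}
    (hy : y ∈ φ.target ∩ φ.symm ⁻¹' φ'.source)
    (h : lieDerivMetric (g.coord φ') (coordField φ' ζ) ((φ' ∘ φ.symm) y) =
      c • g.coord φ' ((φ' ∘ φ.symm) y)) :
    conformalFactor (g.coord φ) (coordField φ ζ) y =
      conformalFactor (g.coord φ') (coordField φ' ζ) ((φ' ∘ φ.symm) y) := by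
  obtain ⟨ho, hm, hs⟩ := transition_isOpen_maps hφ hφ'
  have h1 := lieDerivMetric_naturality ho φ'.open_target hs hm (g.contDiffOn_coord hφ')
    (contDiffOn_euclidean.1 ((hφ.contDiffOn_coordField hζ).mono inter_subset_left))
    (contDiffOn_euclidean.1 (hφ'.contDiffOn_coordField hζ))
    (fun y hy => g.coord_transition hφ hφ' hy) (fun y hy => coordField_transition hφ hφ' ζ hy) hy
  rw [h, Matrix.mul_smul, Matrix.smul_mul, ← g.coord_transition hφ hφ' hy] at h1
  have e1 := (g.isLocalMetric hφ).eq_conformalFactor hy.1 hn h1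
  have e2 := (g.isLocalMetric hφ').eq_conformalFactor (hm hy) hn h
  linarith

end Transition

variable [IsManifold (𝓡 n) ∞ M] {g : Metric n M}

/-- The only possible conformal factor of a vector field on a manifold. -/
noncomputable def globalConformalFactor (g : Metric n M) (ζ : (x : M) → TangentSpace (𝓡 n) x)
    (x : M) : ℝ :=
  conformalFactor (g.coord (chartAt (E n) x)) (coordField (chartAt (E n) x) ζ)
    (chartAt (E n) x x)

/-- The chart used by `globalConformalFactor` varies with the point, so its smoothness is not
evident. Chart independence identifies it in any fixed chart with the smooth local factor. -/
theorem isConformalKilling_of_charts (hn : 0 < n) (hζ : IsSmoothField ζ)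
    (h : ∀ φ : OpenPartialHomeomorph M (E n), IsChart φ →
      IsLocalConformal (g.coord φ) φ.target (coordField φ ζ)
        (conformalFactor (g.coord φ) (coordField φ ζ))) :
    IsConformalKilling g ζ (globalConformalFactor g ζ) := by
  have key : ∀ φ : OpenPartialHomeomorph M (E n), IsChart φ → ∀ y ∈ φ.target,
      globalConformalFactor g ζ (φ.symm y) = conformalFactor (g.coord φ) (coordField φ ζ) y := by
    intro φ hφ y hy
    have hc := isChart_chartAt (n := n) (φ.symm y)
    have hy' : y ∈ φ.target ∩ φ.symm ⁻¹' (chartAt (E n) (φ.symm y)).source :=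
      ⟨hy, mem_chart_source _ _⟩
    exact (conformalFactor_transition hφ hc hn hζ hy'
      ((h _ hc).lieDeriv_eq (mem_chart_target _ _))).symm
  refine ⟨hζ, contMDiff_of_charts fun φ hφ => ?_, fun φ hφ y hy => ?_⟩
  · exact (h φ hφ).smooth_factor.congr fun y hy => key φ hφ y hy
  · rw [key φ hφ y hy]
    exact (h φ hφ).lieDeriv_eq hy

theorem IsConformalKilling.isLocalConformal {ψ : M → ℝ} (h : IsConformalKilling g ζ ψ)
    (hφ : IsChart φ) : IsLocalConformal (g.coord φ) φ.target (coordField φ ζ) (ψ ∘ φ.symm) where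
  smooth_field := contDiffOn_euclidean.1 (hφ.contDiffOn_coordField h.smooth_field)
  smooth_factor := hφ.contDiffOn_comp_symm h.smooth_factor
  lieDeriv_eq hy := h.lieDeriv_eq φ hφ _ hy

theorem IsSmoothFieldOn.isSmoothField {ξ : (x : M) → ℝ → TangentSpace (𝓡 n) x}
    (hξ : IsSmoothFieldOn J ξ) {u : ℝ} (hu : u ∈ J) : IsSmoothField fun x => ξ x u := by
  have h : ContMDiff (𝓡 n) ((𝓡 n).prod 𝓘(ℝ, ℝ)) ∞ (fun x : M => (x, u)) :=
    contMDiff_id.prodMk contMDiff_const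
  exact contMDiffOn_univ.1 (ContMDiffOn.comp
    (g := fun p : M × ℝ => (⟨p.1, ξ p.1 p.2⟩ : TangentBundle (𝓡 n) M)) hξ h.contMDiffOn
    fun _ _ => ⟨mem_univ _, hu⟩)

/-- A function on a connected manifold whose partial derivatives vanish is constant. -/
theorem eq_of_pd_eq_zero [PreconnectedSpace M] {k : M → ℝ}
    (hk : ∀ φ : OpenPartialHomeomorph M (E n), IsChart φ → ContDiffOn ℝ ∞ (k ∘ φ.symm) φ.target)
    (h0 : ∀ φ : OpenPartialHomeomorph M (E n), IsChart φ → ∀ y ∈ φ.target, ∀ j,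
      pd j (k ∘ φ.symm) y = 0) (x z : M) : k x = k z := by
  refine IsLocallyConstant.apply_eq_of_preconnectedSpace ?_ x z
  refine (IsLocallyConstant.iff_eventually_eq k).2 fun x => ?_
  set φ := chartAt (E n) x
  have hφ : IsChart φ := isChart_chartAt x
  -- A ball in the chart is connected, so a vanishing differential makes `k` constant on it; hence
  -- `k` is locally constant on `M`.
  obtain ⟨r, hr, hball⟩ := Metric.isOpen_iff.1 φ.open_target (φ x) (mem_chart_target (E n) x)
  have hconst : ∀ y ∈ Metric.ball (φ x) r, (k ∘ φ.symm) y = (k ∘ φ.symm) (φ x) := fun y hy =>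
    Metric.isOpen_ball.is_const_of_fderiv_eq_zero (𝕜 := ℝ)
      (convex_ball (φ x) r).isPreconnected
      (fun w hw => ((hk φ hφ).differentiableAt_of_isOpen φ.open_target
        (hball hw)).differentiableWithinAt)
      (fun w hw => by
        ext v
        rw [fderiv_apply_eq_sum_pd]
        simp [h0 φ hφ w (hball hw)]) hy (Metric.mem_ball_self hr)
  have hx : x ∈ φ.source := mem_chart_source (E n) x
  filter_upwards [φ.open_source.mem_nhds hx,
    (φ.continuousAt hx).preimage_mem_nhds (Metric.ball_mem_nhds (φ x) hr)] with z hz hz'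
  have := hconst (φ z) hz'
  simpa [Function.comp, φ.left_inv hz, φ.left_inv hx] using this

/-- The field of a Lie point symmetry does not depend on `u`. -/
theorem IsPoissonSymmetry.field_eq (hn : 2 ≤ n) (hJ : IsOpen J) (hJc : IsConnected J)
    {f : M → ℝ → ℝ} (hf : IsSmoothFunOn (n := n) J f) {ξ : (x : M) → ℝ → TangentSpace (𝓡 n) x}
    (hξ : IsSmoothFieldOn J ξ) {η : M → ℝ → ℝ} (hη : IsSmoothFunOn (n := n) J η)
    (h : IsPoissonSymmetry g J f ξ η) (x : M) {u v : ℝ} (hu : u ∈ J) (hv : v ∈ J) :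
    ξ x u = ξ x v := by
  set φ := chartAt (E n) x with hφdef
  have hφ : IsChart φ := isChart_chartAt x
  have hG := g.isLocalMetric hφ
  have hS := hG.isOpen.prod hJ
  have hx : φ x ∈ φ.target := mem_chart_target (E n) x
  have hξc := contDiffOn_euclidean.1 (hφ.contDiffOn_coordField_param hξ)
  have hd : ∀ k, ∀ s ∈ J, deriv (fun s => coordField φ (fun z => ξ z s) (φ x) k) s = 0 := by
    intro k s hs
    refine (du_eq_deriv (A := fun p : E n × ℝ => coordField φ (fun z => ξ z p.2) p.1 k)
      ((hξc k).differentiableAt_of_isOpen hS ⟨hx, hs⟩)).symm.trans ?_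
    exact du_field_eq_zero hn hG hJ (hφ.contDiffOn_coordFun hf) hξc (hφ.contDiffOn_coordFun hη)
      (h φ hφ) hx hs k
  have hc : coordField φ (fun z => ξ z u) (φ x) = coordField φ (fun z => ξ z v) (φ x) := by
    ext k
    refine hJ.is_const_of_deriv_eq_zero hJc.isPreconnected (fun s hs => ?_)
      (fun s hs => hd k s hs) hu hv
    exact (((hξc k).differentiableAt_of_isOpen hS ⟨hx, hs⟩).comp s
      (f := fun s : ℝ => (φ x, s)) (by fun_prop)).differentiableWithinAt
  -- Equality of components gives equality of tangent vectors, because the differential of the chart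
  -- is injective.
  have e1 := hφ.mfderiv_symm_comp hx (ξ (φ.symm (φ x)) u)
  have e2 := hφ.mfderiv_symm_comp hx (ξ (φ.symm (φ x)) v)
  simp only [coordField] at hc
  have e3 : ξ (φ.symm (φ x)) u = ξ (φ.symm (φ x)) v := by
    rw [← e1, ← e2]
    exact congrArg _ hc
  rwa [φ.left_inv (mem_chart_source (E n) x)] at e3

/-- The classification in all dimensions at least two. -/
theorem isPoissonSymmetry_iff [ConnectedSpace M] (hn : 2 ≤ n) (hJ : IsOpen J) (hJc : IsConnected J)
    {f : M → ℝ → ℝ} (hf : IsSmoothFunOn (n := n) J f) {ξ : (x : M) → ℝ → TangentSpace (𝓡 n) x}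
    (hξ : IsSmoothFieldOn J ξ) {η : M → ℝ → ℝ} (hη : IsSmoothFunOn (n := n) J η) :
    IsPoissonSymmetry g J f ξ η ↔
      ∃ (ζ : (x : M) → TangentSpace (𝓡 n) x) (ψ b : M → ℝ) (a₀ : ℝ),
        IsConformalKilling g ζ ψ ∧ ContMDiff (𝓡 n) 𝓘(ℝ, ℝ) ∞ b ∧
        (∀ x, ∀ u ∈ J, ξ x u = ζ x) ∧
        (∀ x, ∀ u ∈ J, η x u = (2 - (n : ℝ)) / 2 * ψ x * u + a₀ * u + b x) ∧
        ∀ φ : OpenPartialHomeomorph M (E n), IsChart φ → ∀ y ∈ φ.target, ∀ u ∈ J,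
          (2 - (n : ℝ)) / 2 * laplacian (g.coord φ) (ψ ∘ φ.symm) y * u
            + laplacian (g.coord φ) (b ∘ φ.symm) y
            - ∑ k, coordField φ ζ y k * pd k (fun z => f (φ.symm z) u) y
            - ((2 - (n : ℝ)) / 2 * ψ (φ.symm y) + a₀) * u * deriv (f (φ.symm y)) u
            + (a₀ - ((n : ℝ) + 2) / 2 * ψ (φ.symm y)) * f (φ.symm y) u
            - b (φ.symm y) * deriv (f (φ.symm y)) u = 0 := by
  have hn0 : 0 < n := by omega
  -- The determining equation in one chart for a field of the required shape; it serves both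
  -- directions, and its right side is the equation of the statement.
  have final : ∀ {ζ : (x : M) → TangentSpace (𝓡 n) x} {ψ b : M → ℝ} {a₀ : ℝ},
      IsConformalKilling g ζ ψ → ContMDiff (𝓡 n) 𝓘(ℝ, ℝ) ∞ b → (∀ x, ∀ u ∈ J, ξ x u = ζ x) →
      (∀ x, ∀ u ∈ J, η x u = (2 - (n : ℝ)) / 2 * ψ x * u + a₀ * u + b x) →
      ∀ φ : OpenPartialHomeomorph M (E n), IsChart φ →
        (IsLocalLieSymmetry φ.target J (poissonFunction (g.coord φ) (coordFun φ f))
          (fun p => coordField φ (fun x => ξ x p.2) p.1) (coordFun φ η) ↔ _) :=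
    fun hK hb hξζ hηb φ hφ => isLocalLieSymmetry_affine_iff hn0 (g.isLocalMetric hφ) hJ
      (hφ.contDiffOn_coordFun hf) (hK.isLocalConformal hφ) (hφ.contDiffOn_comp_symm hb)
      (fun y _ s hs => coordField_congr (hξζ _ s hs)) (fun y _ s hs => hηb _ s hs)
  constructor
  · intro h
    obtain ⟨u₀, hu₀⟩ := hJc.nonempty
    set ζ : (x : M) → TangentSpace (𝓡 n) x := fun x => ξ x u₀ with hζdef
    have hξζ : ∀ x, ∀ u ∈ J, ξ x u = ζ x := fun x u hu =>
      h.field_eq hn hJ hJc hf hξ hη x hu hu₀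
    have hζ : IsSmoothField ζ := hξ.isSmoothField hu₀
    have hfield : ∀ φ : OpenPartialHomeomorph M (E n), ∀ y ∈ φ.target, ∀ s ∈ J,
        (fun p : E n × ℝ => coordField φ (fun x => ξ x p.2) p.1) (y, s) = coordField φ ζ y :=
      fun φ y _ s hs => coordField_congr (hξζ _ s hs)
    have hK : IsConformalKilling g ζ (globalConformalFactor g ζ) :=
      isConformalKilling_of_charts hn0 hζ fun φ hφ =>
        .of_isLocalLieSymmetry hn0 (g.isLocalMetric hφ) hJ hJc.nonempty
          (hφ.contDiffOn_coordFun hf) (hφ.contDiffOn_coordFun hη)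
          (contDiffOn_euclidean.1 (hφ.contDiffOn_coordField hζ)) (hfield φ) (h φ hφ)
    set ψ := globalConformalFactor g ζ
    have hdet := fun (φ : OpenPartialHomeomorph M (E n)) (hφ : IsChart φ) =>
      (isLocalLieSymmetry_conformal_iff hn0 (g.isLocalMetric hφ) hJ (hφ.contDiffOn_coordFun hf)
        (hφ.contDiffOn_coordFun hη) (hK.isLocalConformal hφ) (hfield φ)).1 (h φ hφ)
    have hdu : ∀ φ : OpenPartialHomeomorph M (E n), IsChart φ → ∀ y ∈ φ.target, ∀ s ∈ J,
        DifferentiableAt ℝ (η (φ.symm y)) s ∧ DifferentiableAt ℝ (deriv (η (φ.symm y))) s ∧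
        deriv (η (φ.symm y)) s = du (coordFun φ η) (y, s) ∧
        deriv (deriv (η (φ.symm y))) s = 0 := by
      intro φ hφ y hy s hs
      have hη' := hφ.contDiffOn_coordFun hη
      have hS := φ.open_target.prod hJ
      have line : ∀ s : ℝ, DifferentiableAt ℝ (fun s : ℝ => (y, s)) s := fun s => by fun_prop
      have d1 := fun s hs => hη'.differentiableAt_of_isOpen hS (x := (y, s)) ⟨hy, hs⟩
      have d2 := (hη'.du hS).differentiableAt_of_isOpen hS (x := (y, s)) ⟨hy, hs⟩
      have e1 : ∀ s ∈ J, deriv (η (φ.symm y)) s = du (coordFun φ η) (y, s) :=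
        fun s hs => (du_eq_deriv (d1 s hs)).symm
      have e2 : deriv (η (φ.symm y)) =ᶠ[nhds s] fun s => du (coordFun φ η) (y, s) :=
        Filter.eventuallyEq_of_mem (hJ.mem_nhds hs) e1
      refine ⟨(d1 s hs).comp s (line s), ?_, e1 s hs, ?_⟩
      · exact (d2.comp s (line s)).congr_of_eventuallyEq e2
      · rw [e2.deriv_eq, ← du_eq_deriv d2]
        exact (hdet φ hφ y hy s hs).1
    have hdux : ∀ x, ∀ s ∈ J, DifferentiableAt ℝ (η x) s ∧ DifferentiableAt ℝ (deriv (η x)) s ∧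
        deriv (deriv (η x)) s = 0 := by
      intro x s hs
      have := hdu (chartAt (E n) x) (isChart_chartAt x) _ (mem_chart_target (E n) x) s hs
      rw [(chartAt (E n) x).left_inv (mem_chart_source (E n) x)] at this
      exact ⟨this.1, this.2.1, this.2.2.2⟩
    -- `θ` is `η_u`, independent of `u` because `η_uu = 0` on the connected `J`. Hence `η - θ u`
    -- does not depend on `u` either.
    set θ : M → ℝ := fun x => deriv (η x) u₀ with hθ
    have hθs : ∀ x, ∀ s ∈ J, deriv (η x) s = θ x := fun x s hs =>
      hJ.is_const_of_deriv_eq_zero hJc.isPreconnected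
        (fun s hs => (hdux x s hs).2.1.differentiableWithinAt) (fun s hs => (hdux x s hs).2.2)
        hs hu₀
    have hηθ : ∀ x, ∀ s ∈ J, η x s - θ x * s = η x u₀ - θ x * u₀ := fun x s hs =>
      hJ.is_const_of_deriv_eq_zero (f := fun s => η x s - θ x * s) hJc.isPreconnected
        (fun s hs => ((hdux x s hs).1.fun_sub (by fun_prop)).differentiableWithinAt)
        (fun s hs => by
          rw [deriv_fun_sub (hdux x s hs).1 (by fun_prop), hθs x s hs]
          simp) hs hu₀
    have hkeq : ∀ φ : OpenPartialHomeomorph M (E n), IsChart φ →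
        EqOn ((fun x => θ x - (2 - (n : ℝ)) / 2 * ψ x) ∘ φ.symm)
          (fun y => du (coordFun φ η) (y, u₀) - (2 - (n : ℝ)) / 2 * (ψ ∘ φ.symm) y) φ.target :=
      fun φ hφ y hy => by
        simp only [Function.comp, hθ, (hdu φ hφ y hy u₀ hu₀).2.2.1]
    have hθc : ∀ φ : OpenPartialHomeomorph M (E n), IsChart φ →
        ContDiffOn ℝ ∞ (fun y => du (coordFun φ η) (y, u₀)) φ.target := fun φ hφ =>
      contDiffOn_slice ((hφ.contDiffOn_coordFun hη).du (φ.open_target.prod hJ)) hu₀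
    -- The equation `2 ∂_j η_u = (2 - n) ∂_j ψ` says exactly that this difference has zero gradient
    -- in every chart.
    have hk := eq_of_pd_eq_zero (n := n) (k := fun x => θ x - (2 - (n : ℝ)) / 2 * ψ x)
      (fun φ hφ => ((hθc φ hφ).sub
        (contDiffOn_const.mul (hφ.contDiffOn_comp_symm hK.smooth_factor))).congr (hkeq φ hφ))
      (fun φ hφ y hy j => by
        have hψd := (hφ.contDiffOn_comp_symm hK.smooth_factor).differentiableAt_of_isOpen
          φ.open_target hy
        have hS := φ.open_target.prod hJ
        rw [pd_congr φ.open_target (hkeq φ hφ) hy, pd, fderiv_sub_apply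
          ((hθc φ hφ).differentiableAt_of_isOpen φ.open_target hy) (hψd.const_mul _),
          fderiv_const_mul_apply hψd]
        have h1 := (hdet φ hφ y hy u₀ hu₀).2.1 j
        rw [dx_eq_pd (((hφ.contDiffOn_coordFun hη).du hS).differentiableAt_of_isOpen hS
          ⟨hy, hu₀⟩)] at h1
        simp only [pd] at h1
        linarith)
    obtain ⟨x₀⟩ : Nonempty M := inferInstance
    set a₀ := θ x₀ - (2 - (n : ℝ)) / 2 * ψ x₀ with ha₀
    have hθa : ∀ x, θ x = (2 - (n : ℝ)) / 2 * ψ x + a₀ := fun x => by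
      have := hk x x₀
      rw [ha₀, ← this]
      ring
    -- The witness `b` is the intercept of the affine function `η(x, ·)`, computed at `u₀`; this
    -- form shows that it is smooth even when `0 ∉ J`.
    have hb : ContMDiff (𝓡 n) 𝓘(ℝ, ℝ) ∞
        (fun x => η x u₀ - ((2 - (n : ℝ)) / 2 * ψ x + a₀) * u₀) :=
      (hη.contMDiff hu₀).sub
        (((contMDiff_const.mul hK.smooth_factor).add contMDiff_const).mul contMDiff_const)
    have hηb : ∀ x, ∀ u ∈ J, η x u = (2 - (n : ℝ)) / 2 * ψ x * u + a₀ * u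
        + (η x u₀ - ((2 - (n : ℝ)) / 2 * ψ x + a₀) * u₀) := fun x u hu => by
      have := hηθ x u hu
      rw [hθa] at this
      linarith
    exact ⟨ζ, ψ, _, a₀, hK, hb, hξζ, hηb, fun φ hφ => (final hK hb hξζ hηb φ hφ).1 (h φ hφ)⟩
  · rintro ⟨ζ, ψ, b, a₀, hK, hb, hξζ, hηb, heq⟩ φ hφ
    exact (final hK hb hξζ hηb φ hφ).2 (heq φ hφ)

end Global

end PoissonSymmetry

theorem theorem1 {n : ℕ} {M : Type*} [TopologicalSpace M] [ChartedSpace (E n) M]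
    [IsManifold (𝓡 n) ∞ M] [ConnectedSpace M] (g : Metric n M)
    (J : Set ℝ) (hJ : IsOpen J) (hJc : IsConnected J)
    (f : M → ℝ → ℝ) (hf : IsSmoothFunOn (n := n) J f)
    (ξ : (x : M) → ℝ → TangentSpace (𝓡 n) x) (hξ : IsSmoothFieldOn J ξ)
    (η : M → ℝ → ℝ) (hη : IsSmoothFunOn (n := n) J η) :
    (2 < n →
      (IsPoissonSymmetry g J f ξ η ↔
        ∃ (ζ : (x : M) → TangentSpace (𝓡 n) x) (ψ b : M → ℝ) (a₀ : ℝ),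
          IsConformalKilling g ζ ψ ∧ ContMDiff (𝓡 n) 𝓘(ℝ, ℝ) ∞ b ∧
          (∀ x, ∀ u ∈ J, ξ x u = ζ x) ∧
          (∀ x, ∀ u ∈ J, η x u = (2 - (n : ℝ)) / 2 * ψ x * u + a₀ * u + b x) ∧
          ∀ φ : OpenPartialHomeomorph M (E n), IsChart φ → ∀ y ∈ φ.target, ∀ u ∈ J,
            (2 - (n : ℝ)) / 2 * laplacian (g.coord φ) (ψ ∘ φ.symm) y * u
              + laplacian (g.coord φ) (b ∘ φ.symm) y
              - ∑ k, coordField φ ζ y k * pd k (fun z => f (φ.symm z) u) y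
              - ((2 - (n : ℝ)) / 2 * ψ (φ.symm y) + a₀) * u * deriv (f (φ.symm y)) u
              + (a₀ - ((n : ℝ) + 2) / 2 * ψ (φ.symm y)) * f (φ.symm y) u
              - b (φ.symm y) * deriv (f (φ.symm y)) u = 0)) ∧
    (n = 2 →
      (IsPoissonSymmetry g J f ξ η ↔
        ∃ (ζ : (x : M) → TangentSpace (𝓡 n) x) (ψ b : M → ℝ) (a₀ : ℝ),
          IsConformalKilling g ζ ψ ∧ ContMDiff (𝓡 n) 𝓘(ℝ, ℝ) ∞ b ∧
          (∀ x, ∀ u ∈ J, ξ x u = ζ x) ∧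
          (∀ x, ∀ u ∈ J, η x u = a₀ * u + b x) ∧
          ∀ φ : OpenPartialHomeomorph M (E n), IsChart φ → ∀ y ∈ φ.target, ∀ u ∈ J,
            laplacian (g.coord φ) (b ∘ φ.symm) y
              - ∑ k, coordField φ ζ y k * pd k (fun z => f (φ.symm z) u) y
              - a₀ * u * deriv (f (φ.symm y)) u
              + (a₀ - 2 * ψ (φ.symm y)) * f (φ.symm y) u
              - b (φ.symm y) * deriv (f (φ.symm y)) u = 0)) := by
  refine ⟨fun hn => isPoissonSymmetry_iff hn.le hJ hJc hf hξ hη, fun hn => ?_⟩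
  rw [isPoissonSymmetry_iff hn.ge hJ hJc hf hξ hη]
  -- In dimension two the coefficient `(2 - n)/2` vanishes, which removes `ψ` from `η` and `Δψ` from
  -- the equation; the factor of `ψ f` becomes 2.
  have h1 : (2 - (n : ℝ)) / 2 = 0 := by rw [hn]; norm_num
  have h2 : ((n : ℝ) + 2) / 2 = 2 := by rw [hn]; norm_num
  simp only [h1, h2, zero_mul, zero_add]
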